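/- For $a\in[-1,0)$ and $\xi\in\mathbb R$ let $$V_a(\xi,t)=\begin{cases}(\xi+at)^2,& t<0,\\ (\xi+t)^2,& t>0,\end{cases}\qquad q_a[\xi](u)=\int_{\mathbb R}\big(|u'(t)|^2+V_a(\xi,t)|u(t)|^2\big)\,dt,$$ where $u\in B^1(\mathbb R)=\{u\in L^2(\mathbb R): u'\in L^2(\mathbb R),\ tu\in L^2(\mathbb R)\}$ (complex-valued functions, weak derivatives), and let $$\mu_a(\xi)=\inf_{u\in B^1(\mathbb R),\,u\ne0}\frac{q_a[\xi](u)}{\|u\|_{L^2(\mathbb R)}^2}.$$ Let $\mathfrak h_a[\xi]=-\frac{d^2}{dt^2}+V_a(\xi,t)$ with domain $\{u\in B^1(\mathbb R): (-\frac{d^2}{dt^2}+V_a(\xi,t))u\in L^2(\mathbb R),\ u'(0_+)=u'(0_-)\}$, where the differential expression is taken in the sense of distributions on $\mathbb R\setminus\{0\}$. Then, for every $a\in[-1,0)$ and $\xi\in\mathbb R$, there is exactly one function $f_{a,\xi}$ (taken as its continuous representative) that is positive on $\mathbb R$, satisfies $\|f_{a,\xi}\|_{L^2(\mathbb R)}=1$,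 belongs to the domain of $\mathfrak h_a[\xi]$ and satisfies $\mathfrak h_a[\xi]f_{a,\xi}=\mu_a(\xi)f_{a,\xi}$; the one-sided limits $$\gamma_a(\xi)=\Big(\frac{f_{a,\xi}'}{f_{a,\xi}}\Big)(0_+)=\Big(\frac{f_{a,\xi}'}{f_{a,\xi}}\Big)(0_-)$$ exist and coincide; and $\mu_a$ is differentiable at $\xi$ with $$\partial_\xi\mu_a(\xi)=\Big(1-\frac1a\Big)\big(\gamma_a(\xi)^2+\mu_a(\xi)-\xi^2\big)\,|f_{a,\xi}(0)|^2 .$$ -/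

import Mathlib

open MeasureTheory Filter Topology
open scoped ContDiff

noncomputable section

namespace StepField

/-- `v` is the weak (distributional) derivative of `u` on the open set `Ω ⊆ ℝ`. -/
structure HasWeakDerivOn (Ω : Set ℝ) (u v : ℝ → ℂ) : Prop where
  locallyIntegrableOn : LocallyIntegrableOn u Ω
  locallyIntegrableOn_deriv : LocallyIntegrableOn v Ω
  integral_eq : ∀ φ : ℝ → ℝ, ContDiff ℝ ∞ φ → HasCompactSupport φ → tsupport φ ⊆ Ω →
    ∫ t, deriv φ t • u t = - ∫ t, φ t • v t

/-- The space `B¹(ℝ)` of those `u ∈ L²(ℝ)` for which `t u` and the weak derivative `u'` are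
also in `L²(ℝ)`. -/
structure MemB1 (u : ℝ → ℂ) : Prop where
  memLp : MemLp u 2
  memLp_mul : MemLp (fun t : ℝ => t • u t) 2
  exists_weakDeriv : ∃ v, HasWeakDerivOn Set.univ u v ∧ MemLp v 2

open Classical in
/-- The weak derivative of `u` on `ℝ` (unique up to a null set when it exists). -/
def weakDeriv (u : ℝ → ℂ) : ℝ → ℂ :=
  if h : ∃ v, HasWeakDerivOn Set.univ u v then h.choose else 0

/-- The potential `V_a(ξ, t)`: `(ξ + a t)²` for `t < 0` and `(ξ + t)²` for `t > 0`. -/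
def potential (a ξ t : ℝ) : ℝ :=
  if t < 0 then (ξ + a * t) ^ 2 else (ξ + t) ^ 2

/-- The quadratic form `q_a[ξ](u) = ∫ (|u'|² + V_a(ξ, t) |u|²) dt`, meant for `u ∈ B¹(ℝ)`. -/
def quadForm (a ξ : ℝ) (u : ℝ → ℂ) : ℝ :=
  ∫ t, (‖weakDeriv u t‖ ^ 2 + potential a ξ t * ‖u t‖ ^ 2)

/-- The ground state energy `μ_a(ξ)`: the infimum of the Rayleigh quotients
`q_a[ξ](u) / ‖u‖²` over the nonzero `u ∈ B¹(ℝ)`. -/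
def groundEnergy (a ξ : ℝ) : ℝ :=
  sInf {r : ℝ | ∃ u : ℝ → ℂ, MemB1 u ∧ ¬ (u =ᵐ[volume] 0) ∧
    r = quadForm a ξ u / ∫ t, ‖u t‖ ^ 2}

/-- `u` is in the domain of the fiber operator `𝔥_a[ξ] = -d²/dt² + V_a(ξ, t)` and
`𝔥_a[ξ] u = w`. Here `v` and `z` are the first and second weak derivatives of `u`, the second
one taken away from `0`; the last two conditions say `u'(0₊) = u'(0₋)`. -/
def FiberOperator (a ξ : ℝ) (u w : ℝ → ℂ) : Prop :=
  MemB1 u ∧ MemLp w 2 ∧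
    ∃ (v z : ℝ → ℂ) (L : ℂ),
      HasWeakDerivOn Set.univ u v ∧ HasWeakDerivOn {0}ᶜ v z ∧
      (w =ᵐ[volume] fun t => - z t + potential a ξ t • u t) ∧
      Tendsto v (𝓝[>] 0) (𝓝 L) ∧ Tendsto v (𝓝[<] 0) (𝓝 L)

/-- `f` is a positive `L²`-normalized eigenfunction of `𝔥_a[ξ]` for the eigenvalue `μ_a(ξ)`.
Eigenfunctions are represented by their continuous representatives, so that `f(0)` makes
sense. -/
structure IsPositiveGroundState (a ξ : ℝ) (f : ℝ → ℝ) : Prop where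
  continuous : Continuous f
  pos : ∀ t, 0 < f t
  normalized : ∫ t, f t ^ 2 = 1
  eigen : FiberOperator a ξ (fun t => (f t : ℂ)) (fun t => groundEnergy a ξ • (f t : ℂ))

end StepField

end

/-! The problem reduces to classical solutions of `f'' = (V - L) f`. Shooting on `[-r, r]` and
letting `r → ∞` gives a bounded positive solution for some `L` (`exists_bounded_positive_solution`).
Since `V` exceeds `L + 1` outside a compact set, `f` and `f'` decay exponentially, and `f` can be
normalized.

That `L` is the infimum of the Rayleigh quotients follows from Picone's identity: `|u'|² + (V -
L)|u|²` is the square `|u' - (f'/f) u|²` plus the derivative of `(f'/f) u²` for real `u`, and a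
linear bound on `f'/f` controls the boundary terms (`IsGround.picone_le`). Conversely, a weak
positive ground state is a classical solution, because its derivative has equal one-sided limits at
`0`. The Wronskian of two ground states is constant and integrable, hence zero, which gives
uniqueness.

For the derivative, `V` is a quadratic polynomial in the parameter. Testing the form at `η` with the
ground state at `ξ`, and vice versa, squeezes the difference quotient between the Feynman–Hellmann
integrals `∫ ∂_ξ V f²` at `ξ` and at `η`, up to `|η - ξ|` (`IsGround.energy_le`). It remains to see
that this integral is continuous: the Picone remainder of `f_η` against `f_ξ` is `O(|η - ξ|)`, so
`f_η / f_ξ` is locally almost constant; normalization fixes the constant, and uniform decay permits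
dominated convergence.

The boundary formula comes from `P = f'² - (V - L) f²`, which satisfies `P' = -(∂_t V) f²`. As `∂_t
V` equals `∂_ξ V` for `t > 0` and `a ∂_ξ V` for `t < 0`, the two half-line integrals are `P(0)` and
`-P(0)/a` (`IsGround.integral_profile`). -/

namespace StepField

/-! ### Global existence for linear differential equations -/

section LinearODE

variable {E : Type*} [NormedAddCommGroup E] [NormedSpace ℝ E]

/-- The Picard iterates of the linear equation `X' = A(t) X`, `X(0) = x₀`. -/
noncomputable def picardTerm (A : ℝ → E →L[ℝ] E) (x₀ : E) : ℕ → ℝ → E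
  | 0 => fun _ => x₀
  | k + 1 => fun t => ∫ s in (0 : ℝ)..t, A s (picardTerm A x₀ k s)

theorem continuous_picardTerm {A : ℝ → E →L[ℝ] E} (hA : Continuous A) (x₀ : E) (k : ℕ) :
    Continuous (picardTerm A x₀ k) := by
  induction k with
  | zero => exact continuous_const
  | succ k ih =>
    exact intervalIntegral.continuous_primitive
      (fun a b => (hA.clm_apply ih).intervalIntegrable a b) 0

theorem hasDerivAt_picardTerm_succ [CompleteSpace E] {A : ℝ → E →L[ℝ] E} (hA : Continuous A) (x₀ : E) (k : ℕ)
    (t : ℝ) : HasDerivAt (picardTerm A x₀ (k + 1)) (A t (picardTerm A x₀ k t)) t :=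
  (hA.clm_apply (continuous_picardTerm hA x₀ k)).integral_hasStrictDerivAt 0 t |>.hasDerivAt

/-- Each integration of `|s|^k` contributes a factor `1/(k+1)`. The resulting factorial makes the
Picard series converge on every bounded interval, so no continuation argument is needed. -/
theorem norm_picardTerm_le {A : ℝ → E →L[ℝ] E} {R K : ℝ}
    (hK : ∀ t, |t| ≤ R → ‖A t‖ ≤ K) (hK0 : 0 ≤ K) (x₀ : E) (k : ℕ) (t : ℝ) (ht : |t| ≤ R) :
    ‖picardTerm A x₀ k t‖ ≤ ‖x₀‖ * (K ^ k * |t| ^ k / k.factorial) := by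
  induction k generalizing t with
  | zero => simp [picardTerm]
  | succ k ih =>
    have hc : Continuous fun s : ℝ => K * (‖x₀‖ * (K ^ k * |s| ^ k / k.factorial)) := by fun_prop
    have hle : ∀ s, |s| ≤ R → ‖A s (picardTerm A x₀ k s)‖ ≤
        K * (‖x₀‖ * (K ^ k * |s| ^ k / k.factorial)) := fun s hs =>
      ((A s).le_opNorm _).trans (mul_le_mul (hK s hs) (ih s hs) (norm_nonneg _) hK0)
    have key : ∀ t, 0 ≤ t → ∫ s in (0 : ℝ)..t, K * (‖x₀‖ * (K ^ k * s ^ k / k.factorial)) =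
        ‖x₀‖ * (K ^ (k + 1) * t ^ (k + 1) / (k + 1).factorial) := by
      intro t _
      have : (fun s : ℝ => K * (‖x₀‖ * (K ^ k * s ^ k / k.factorial))) =
          fun s => (K ^ (k + 1) * ‖x₀‖ / k.factorial) * s ^ k := by
        funext s; ring
      rw [this, intervalIntegral.integral_const_mul, integral_pow, Nat.factorial_succ]
      have := Nat.factorial_ne_zero k
      push_cast
      field_simp
      ring
    rcases le_total 0 t with h0 | h0
    · rw [abs_of_nonneg h0, ← key t h0]
      refine intervalIntegral.norm_integral_le_of_norm_le h0 (ae_of_all _ fun s hs => ?_)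
        (Continuous.intervalIntegrable (by fun_prop) _ _)
      have hs0 := hs.1.le
      have := hle s (by rw [abs_of_nonneg hs0]; rw [abs_of_nonneg h0] at ht; linarith [hs.2])
      rwa [abs_of_nonneg hs0] at this
    · have h0' : 0 ≤ -t := by linarith
      rw [abs_of_nonpos h0, ← key (-t) h0']
      have hrefl : picardTerm A x₀ (k + 1) t =
          - ∫ s in (0 : ℝ)..(-t), A (-s) (picardTerm A x₀ k (-s)) := by
        rw [intervalIntegral.integral_comp_neg (fun s => A s (picardTerm A x₀ k s)),
          neg_neg, neg_zero, intervalIntegral.integral_symm, neg_neg]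
        rfl
      rw [hrefl, norm_neg]
      refine intervalIntegral.norm_integral_le_of_norm_le h0' (ae_of_all _ fun s hs => ?_)
        (Continuous.intervalIntegrable (by fun_prop) _ _)
      have hs0 := hs.1.le
      have := hle (-s) (by
        rw [abs_neg, abs_of_nonneg hs0]; rw [abs_of_nonpos h0] at ht; linarith [hs.2])
      rwa [abs_neg, abs_of_nonneg hs0] at this

/-- Global existence for linear differential equations. -/
theorem exists_linear_solution [CompleteSpace E] {A : ℝ → E →L[ℝ] E} (hA : Continuous A) (x₀ : E) :
    ∃ X : ℝ → E, X 0 = x₀ ∧ ∀ t, HasDerivAt X (A t (X t)) t := by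
  have bound : ∀ R, 0 ≤ R → ∃ K, 0 ≤ K ∧ ∀ t, |t| ≤ R → ‖A t‖ ≤ K := by
    intro R hR
    obtain ⟨K, hK⟩ := (isCompact_Icc (a := -R) (b := R)).exists_bound_of_continuousOn
      hA.continuousOn
    exact ⟨K, (norm_nonneg _).trans (hK 0 ⟨by linarith, hR⟩), fun t ht => hK t (abs_le.1 ht)⟩
  have hsum : ∀ K R : ℝ, Summable fun k : ℕ => ‖x₀‖ * (K ^ k * R ^ k / k.factorial) := by
    intro K R
    refine Summable.mul_left _ ?_
    simpa [mul_pow] using Real.summable_pow_div_factorial (K * R)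
  have hsummable : ∀ t, Summable fun k => picardTerm A x₀ k t := by
    intro t
    obtain ⟨K, hK0, hK⟩ := bound |t| (abs_nonneg t)
    exact Summable.of_norm_bounded (hsum K |t|)
      fun k => norm_picardTerm_le hK hK0 x₀ k t le_rfl
  refine ⟨fun t => ∑' k, picardTerm A x₀ k t, ?_, fun t => ?_⟩
  · beta_reduce
    rw [tsum_eq_single 0]
    · rfl
    · intro k hk
      obtain ⟨k, rfl⟩ := Nat.exists_eq_succ_of_ne_zero hk
      simp [picardTerm]
  · set R := |t| + 1
    have hR : 0 ≤ R := by positivity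
    obtain ⟨K, hK0, hK⟩ := bound R hR
    -- Termwise derivatives and their majorants carry an index shift: the zeroth iterate is
    -- constant, and iterate `k + 1` has derivative `A` applied to iterate `k`.
    let g' : ℕ → ℝ → E := fun k s => Nat.casesOn k 0 fun k => A s (picardTerm A x₀ k s)
    let b : ℕ → ℝ := fun k => Nat.casesOn k 0 fun k => K * (‖x₀‖ * (K ^ k * R ^ k / k.factorial))
    have hb : Summable b := (summable_nat_add_iff 1).1 ((hsum K R).mul_left K)
    have hmem : t ∈ Metric.ball (0 : ℝ) R := by simp [R]
    have := hasDerivAt_tsum_of_isPreconnected (g := fun k s => picardTerm A x₀ k s) (g' := g')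
      (u := b) hb Metric.isOpen_ball (convex_ball (0 : ℝ) R).isPreconnected
      (fun k s _ => by
        cases k with
        | zero => exact hasDerivAt_const _ _
        | succ k => exact hasDerivAt_picardTerm_succ hA x₀ k s)
      (fun k s hs => by
        have hs' : |s| ≤ R := by simpa using (Metric.mem_ball.1 hs).le
        cases k with
        | zero => simp [g', b]
        | succ k =>
          refine ((A s).le_opNorm _).trans (mul_le_mul (hK s hs') ?_ (norm_nonneg _) hK0)
          refine (norm_picardTerm_le hK hK0 x₀ k s hs').trans ?_
          gcongr)
      hmem (hsummable t) hmem
    convert this using 1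
    have h1 : Summable fun k => g' k t :=
      (summable_nat_add_iff 1).1 ((A t).summable (hsummable t))
    rw [h1.tsum_eq_zero_add, (A t).map_tsum (hsummable t)]
    simp [g']

end LinearODE

/-! ### The equation `u'' = Q u`: uniqueness, positivity, monotonicity -/

/-- `u` solves `u'' = Q u`, and `v = u'`. -/
structure IsSol (Q u v : ℝ → ℝ) : Prop where
  fst : ∀ t, HasDerivAt u (v t) t
  snd : ∀ t, HasDerivAt v (Q t * u t) t

theorem exists_isSol_zero {Q : ℝ → ℝ} (hQ : Continuous Q) (α β : ℝ) :
    ∃ u v, IsSol Q u v ∧ u 0 = α ∧ v 0 = β := by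
  let A : ℝ → (ℝ × ℝ) →L[ℝ] (ℝ × ℝ) := fun t =>
    (ContinuousLinearMap.inl ℝ ℝ ℝ).comp (ContinuousLinearMap.snd ℝ ℝ ℝ) +
      Q t • (ContinuousLinearMap.inr ℝ ℝ ℝ).comp (ContinuousLinearMap.fst ℝ ℝ ℝ)
  have hA : Continuous A := by fun_prop
  obtain ⟨X, h0, hX⟩ := exists_linear_solution hA (α, β)
  refine ⟨fun t => (X t).1, fun t => (X t).2, ⟨fun t => ?_, fun t => ?_⟩, by simp [h0],
    by simp [h0]⟩
  · simpa [A, Function.comp_def] using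
      (ContinuousLinearMap.fst ℝ ℝ ℝ).hasFDerivAt.comp_hasDerivAt t (hX t)
  · simpa [A, Function.comp_def] using
      (ContinuousLinearMap.snd ℝ ℝ ℝ).hasFDerivAt.comp_hasDerivAt t (hX t)

namespace IsSol

variable {Q u v : ℝ → ℝ}

theorem continuous_fst (h : IsSol Q u v) : Continuous u :=
  continuous_iff_continuousAt.2 fun t => (h.fst t).continuousAt

theorem continuous_snd (h : IsSol Q u v) : Continuous v :=
  continuous_iff_continuousAt.2 fun t => (h.snd t).continuousAt

theorem comp_neg (h : IsSol Q u v) :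
    IsSol (fun t => Q (-t)) (fun t => u (-t)) (fun t => - v (-t)) := by
  refine ⟨fun t => ?_, fun t => ?_⟩
  · simpa [Function.comp_def] using (h.fst (-t)).scomp t (hasDerivAt_neg t)
  · simpa [Function.comp_def] using ((h.snd (-t)).scomp t (hasDerivAt_neg t)).fun_neg

theorem comp_add (h : IsSol Q u v) (s : ℝ) :
    IsSol (fun t => Q (t + s)) (fun t => u (t + s)) (fun t => v (t + s)) :=
  ⟨fun t => (h.fst (t + s)).comp_add_const t s, fun t => (h.snd (t + s)).comp_add_const t s⟩

theorem const_mul (h : IsSol Q u v) (c : ℝ) :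
    IsSol Q (fun t => c * u t) (fun t => c * v t) :=
  ⟨fun t => (h.fst t).const_mul c, fun t => by
    have := (h.snd t).const_mul c
    rwa [mul_left_comm] at this⟩

/-- The difference of the two solutions satisfies the first system with forcing `(Q - Q₁) u₁`.
Assuming `1 ≤ M` lets one constant serve both components, as the first one is just `u' = v`. -/
theorem abs_sub_le_gronwallBound {Q₁ u₁ v₁ : ℝ → ℝ} (h : IsSol Q u v) (h₁ : IsSol Q₁ u₁ v₁)
    {M ε δ a b : ℝ} (hM : 1 ≤ M) (hQ : ∀ t ∈ Set.Icc a b, |Q t| ≤ M)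
    (hε : ∀ t ∈ Set.Icc a b, |Q t - Q₁ t| * |u₁ t| ≤ ε)
    (hu : |u a - u₁ a| ≤ δ) (hv : |v a - v₁ a| ≤ δ) :
    ∀ t ∈ Set.Icc a b, |u t - u₁ t| ≤ gronwallBound δ M ε (t - a) ∧
      |v t - v₁ t| ≤ gronwallBound δ M ε (t - a) := by
  intro t ht
  have key := norm_le_gronwallBound_of_norm_deriv_right_le
    (f := fun t => (u t - u₁ t, v t - v₁ t))
    (f' := fun t => (v t - v₁ t, Q t * u t - Q₁ t * u₁ t)) (δ := δ) (K := M) (ε := ε)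
    (a := a) (b := b)
    (((h.continuous_fst.sub h₁.continuous_fst).prodMk
      (h.continuous_snd.sub h₁.continuous_snd)).continuousOn)
    (fun s _ => (((h.fst s).sub (h₁.fst s)).prodMk ((h.snd s).sub (h₁.snd s))).hasDerivWithinAt)
    (by simpa [Prod.norm_def] using ⟨hu, hv⟩)
    (fun s hs => by
      have hs' := Set.Ico_subset_Icc_self hs
      have hε0 : 0 ≤ ε := le_trans (by positivity) (hε s hs')
      set N := ‖(u s - u₁ s, v s - v₁ s)‖ with hN
      have h1 : |u s - u₁ s| ≤ N := by simp [hN, Prod.norm_def]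
      have h2 : |v s - v₁ s| ≤ N := by simp [hN, Prod.norm_def]
      have hN0 : 0 ≤ N := norm_nonneg _
      rw [Prod.norm_def]
      refine max_le ?_ ?_
      · simp only [Real.norm_eq_abs]; nlinarith
      · have : Q s * u s - Q₁ s * u₁ s = Q s * (u s - u₁ s) + (Q s - Q₁ s) * u₁ s := by ring
        simp only [Real.norm_eq_abs]
        rw [this]
        refine (abs_add_le _ _).trans ?_
        rw [abs_mul, abs_mul]
        exact add_le_add (mul_le_mul (hQ s hs') h1 (abs_nonneg _) (by linarith)) (hε s hs'))
    t ht
  simpa [Prod.norm_def] using key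

theorem eq_zero_of_eq_zero_right (hQ : Continuous Q) (h : IsSol Q u v) {a : ℝ} (hu : u a = 0)
    (hv : v a = 0) {t : ℝ} (ht : a ≤ t) : u t = 0 := by
  obtain ⟨M, hM⟩ := (isCompact_Icc (a := a) (b := t)).exists_bound_of_continuousOn
    hQ.continuousOn
  have h0 : IsSol Q (fun _ => 0) (fun _ => 0) :=
    ⟨fun t => hasDerivAt_const _ _, fun t => by simpa using hasDerivAt_const t (0 : ℝ)⟩
  have := (h.abs_sub_le_gronwallBound h0 (M := max M 1) (ε := 0) (δ := 0) (b := t)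
    (le_max_right _ _) (fun s hs => (hM s hs).trans (le_max_left _ _)) (by simp)
    (by simp [hu]) (by simp [hv]) t ⟨ht, le_rfl⟩).1
  simpa [gronwallBound_ε0_δ0] using this

theorem eq_zero_of_eq_zero (hQ : Continuous Q) (h : IsSol Q u v) {a : ℝ} (hu : u a = 0)
    (hv : v a = 0) (t : ℝ) : u t = 0 := by
  rcases le_total a t with ht | ht
  · exact h.eq_zero_of_eq_zero_right hQ hu hv ht
  · have := h.comp_neg.eq_zero_of_eq_zero_right (hQ.comp continuous_neg) (a := -a) (t := -t)
      (by simpa using hu) (by simpa using hv) (by linarith)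
    simpa using this

end IsSol

theorem exists_isSol {Q : ℝ → ℝ} (hQ : Continuous Q) (s α β : ℝ) :
    ∃ u v, IsSol Q u v ∧ u s = α ∧ v s = β := by
  obtain ⟨u, v, h, hu, hv⟩ := exists_isSol_zero (hQ.comp (continuous_add_const s)) α β
  refine ⟨fun t => u (t + -s), fun t => v (t + -s), ?_, by simpa using hu, by simpa using hv⟩
  simpa [Function.comp_def] using h.comp_add (-s)

namespace IsSol

variable {Q u v : ℝ → ℝ}

/-- An interior zero would be a minimum, hence a double zero, and Cauchy uniqueness would make `u`
vanish identically. -/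
theorem pos_of_nonneg (hQ : Continuous Q) (h : IsSol Q u v) {a b : ℝ}
    (hu : ∀ t ∈ Set.Icc a b, 0 ≤ u t) {s : ℝ} (hs : 0 < u s) {t : ℝ} (ht : t ∈ Set.Ioo a b) :
    0 < u t := by
  refine (hu t ⟨ht.1.le, ht.2.le⟩).lt_of_ne' fun h0 => ?_
  have hmin : IsLocalMin u t := by
    filter_upwards [Ioo_mem_nhds ht.1 ht.2] with x hx
    rw [h0]
    exact hu x ⟨hx.1.le, hx.2.le⟩
  exact hs.ne' (h.eq_zero_of_eq_zero hQ h0 (hmin.hasDerivAt_eq_zero (h.fst t)) s)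

/-- Sturm comparison with `cos (π t / 2)`, which vanishes at `±1`. If `u` were positive, the
Wronskian-type expression below would be nonincreasing, yet negative at `-1` and positive at `1`. -/
theorem not_pos_of_le (h : IsSol Q u v) (hQ : ∀ t ∈ Set.Icc (-1 : ℝ) 1, Q t ≤ -(Real.pi / 2) ^ 2) :
    ¬ ∀ t ∈ Set.Icc (-1 : ℝ) 1, 0 < u t := by
  intro hu
  set κ := Real.pi / 2 with hκ
  have hκ0 : 0 < κ := by positivity
  have hW : ∀ t, HasDerivAt (fun t => v t * Real.cos (κ * t) + κ * (u t * Real.sin (κ * t)))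
      ((Q t + κ ^ 2) * (u t * Real.cos (κ * t))) t := by
    intro t
    have hl : HasDerivAt (fun t : ℝ => κ * t) κ t := by simpa using (hasDerivAt_id t).const_mul κ
    have := ((h.snd t).mul hl.cos).add (((h.fst t).mul hl.sin).const_mul κ)
    exact this.congr_deriv (by ring)
  have hanti : AntitoneOn (fun t => v t * Real.cos (κ * t) + κ * (u t * Real.sin (κ * t)))
      (Set.Icc (-1) 1) := by
    refine antitoneOn_of_deriv_nonpos (convex_Icc _ _)
      (fun t _ => (hW t).continuousAt.continuousWithinAt)
      (fun t _ => (hW t).differentiableAt.differentiableWithinAt) fun t ht => ?_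
    rw [interior_Icc] at ht
    have ht' := Set.Ioo_subset_Icc_self ht
    rw [(hW t).deriv]
    refine mul_nonpos_of_nonpos_of_nonneg (by linarith [hQ t ht']) ?_
    refine mul_nonneg (hu t ht').le (Real.cos_nonneg_of_mem_Icc ⟨?_, ?_⟩) <;>
      nlinarith [ht.1, ht.2]
  have h1 := hanti (Set.left_mem_Icc.2 (by norm_num)) (Set.right_mem_Icc.2 (by norm_num))
    (by norm_num : (-1 : ℝ) ≤ 1)
  have hc : Real.cos κ = 0 := Real.cos_pi_div_two
  have hs : Real.sin κ = 1 := Real.sin_pi_div_two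
  simp [hc, hs] at h1
  have e1 := mul_pos hκ0 (hu 1 (by simp))
  have e2 := mul_pos hκ0 (hu (-1) (by simp))
  linarith

/-- `(u v)' = v² + Q u² ≥ 0` and `u v` vanishes at `a`, so `u²` cannot drop below its initial value
`1` and `u` has no zero to the right. -/
theorem pos_of_nonneg_potential (h : IsSol Q u v) (hQ : ∀ t, 0 ≤ Q t) {a : ℝ} (hu : u a = 1)
    (hv : v a = 0) {t : ℝ} (ht : a ≤ t) : 0 < u t := by
  have hm : Monotone fun t => u t * v t := by
    refine monotone_of_deriv_nonneg
      (fun t => ((h.fst t).fun_mul (h.snd t)).differentiableAt) fun t => ?_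
    rw [((h.fst t).fun_mul (h.snd t)).deriv]
    nlinarith [hQ t, mul_nonneg (hQ t) (sq_nonneg (u t)), sq_nonneg (v t)]
  have hd : ∀ s, HasDerivAt (fun s => u s ^ 2) (2 * (u s * v s)) s := fun s => by
    have := (h.fst s).fun_pow 2
    exact this.congr_deriv (by push_cast; ring)
  have hsq : ∀ s, a ≤ s → 1 ≤ u s ^ 2 := by
    intro s hs
    have : MonotoneOn (fun s => u s ^ 2) (Set.Ici a) := by
      refine monotoneOn_of_deriv_nonneg (convex_Ici a)
        (fun s _ => (hd s).continuousAt.continuousWithinAt)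
        (fun s _ => (hd s).differentiableAt.differentiableWithinAt) fun s hs => ?_
      rw [interior_Ici] at hs
      rw [(hd s).deriv]
      have := hm hs.le
      simp only [hv, mul_zero] at this
      linarith
    simpa [hu] using this (Set.mem_Ici.2 le_rfl) (Set.mem_Ici.2 hs) hs
  by_contra! hneg
  obtain ⟨s, hs, hs0⟩ := intermediate_value_Icc' ht h.continuous_fst.continuousOn
    (show (0 : ℝ) ∈ Set.Icc (u t) (u a) from ⟨hneg, by rw [hu]; norm_num⟩)
  have := hsq s hs.1
  rw [hs0] at this
  norm_num at this

theorem monotoneOn_snd (h : IsSol Q u v) {a b : ℝ} (hQ : ∀ t ∈ Set.Icc a b, 0 ≤ Q t)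
    (hu : ∀ t ∈ Set.Icc a b, 0 ≤ u t) : MonotoneOn v (Set.Icc a b) := by
  refine monotoneOn_of_deriv_nonneg (convex_Icc a b) h.continuous_snd.continuousOn
    (fun s _ => (h.snd s).differentiableAt.differentiableWithinAt) fun s hs => ?_
  have hs' := interior_subset hs
  rw [(h.snd s).deriv]
  exact mul_nonneg (hQ s hs') (hu s hs')

theorem monotoneOn_fst (h : IsSol Q u v) {a b : ℝ} (hQ : ∀ t ∈ Set.Icc a b, 0 ≤ Q t)
    (hu : ∀ t ∈ Set.Icc a b, 0 ≤ u t) (hv : 0 ≤ v a) : MonotoneOn u (Set.Icc a b) := by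
  refine monotoneOn_of_deriv_nonneg (convex_Icc a b) h.continuous_fst.continuousOn
    (fun s _ => (h.fst s).differentiableAt.differentiableWithinAt) fun s hs => ?_
  have hs' := interior_subset hs
  rw [(h.fst s).deriv]
  exact hv.trans (h.monotoneOn_snd hQ hu (Set.left_mem_Icc.2 (hs'.1.trans hs'.2)) hs' hs'.1)

/-- Here `u` is convex, so a positive slope at one point would persist and keep `u b` positive.
Together with `monotoneOn_fst` this bounds the approximate ground states outside a fixed compact
set. -/
theorem antitoneOn_fst (h : IsSol Q u v) {a b : ℝ} (hQ : ∀ t ∈ Set.Icc a b, 0 ≤ Q t)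
    (hu : ∀ t ∈ Set.Icc a b, 0 ≤ u t) (hb : u b = 0) : AntitoneOn u (Set.Icc a b) := by
  have hv : ∀ t ∈ Set.Ico a b, v t ≤ 0 := by
    intro t ht
    by_contra! hpos
    have hsub : Set.Icc t b ⊆ Set.Icc a b := Set.Icc_subset_Icc_left ht.1
    have hstrict : StrictMonoOn u (Set.Icc t b) := by
      refine strictMonoOn_of_deriv_pos (convex_Icc t b) h.continuous_fst.continuousOn
        fun s hs => ?_
      have hs' := interior_subset hs
      rw [(h.fst s).deriv]
      exact hpos.trans_le (h.monotoneOn_snd hQ hu ⟨ht.1, ht.2.le⟩ (hsub hs') hs'.1)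
    have := hstrict (Set.left_mem_Icc.2 ht.2.le) (Set.right_mem_Icc.2 ht.2.le) ht.2
    linarith [hu t ⟨ht.1, ht.2.le⟩]
  refine antitoneOn_of_deriv_nonpos (convex_Icc a b) h.continuous_fst.continuousOn
    (fun s _ => (h.fst s).differentiableAt.differentiableWithinAt) fun s hs => ?_
  rw [interior_Icc] at hs
  rw [(h.fst s).deriv]
  exact hv s ⟨hs.1.le, hs.2⟩

end IsSol

/-! ### Continuous dependence on energy and initial data -/

theorem tendsto_gronwallBound_zero {ι : Type*} {l : Filter ι} {δ ε : ι → ℝ} (M x : ℝ)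
    (hδ : Tendsto δ l (𝓝 0)) (hε : Tendsto ε l (𝓝 0)) :
    Tendsto (fun i => gronwallBound (δ i) M (ε i) x) l (𝓝 0) := by
  have : Continuous fun p : ℝ × ℝ => gronwallBound p.1 M p.2 x := by
    rcases eq_or_ne M 0 with rfl | hM
    · simp only [gronwallBound_K0]; fun_prop
    · simp only [gronwallBound_of_K_ne_0 hM]; fun_prop
  have h := (this.tendsto (0, 0)).comp (hδ.prodMk_nhds hε)
  simpa [Function.comp_def, gronwallBound_ε0_δ0] using h

section Family

variable {V : ℝ → ℝ} {ι : Type*} {l : Filter ι} {lam : ι → ℝ} {L : ℝ} {u v : ι → ℝ → ℝ}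
  {f g : ℝ → ℝ}

/-- Locally uniform dependence of solutions on the energy and the initial data. -/
theorem eventually_abs_sub_lt (hV : Continuous V)
    (hu : ∀ i, IsSol (fun t => V t - lam i) (u i) (v i)) (hf : IsSol (fun t => V t - L) f g)
    (hlam : Tendsto lam l (𝓝 L)) {a b : ℝ} (hua : Tendsto (fun i => u i a) l (𝓝 (f a)))
    (hva : Tendsto (fun i => v i a) l (𝓝 (g a))) {ε : ℝ} (hε : 0 < ε) :
    ∀ᶠ i in l, ∀ t ∈ Set.Icc a b, |u i t - f t| < ε := by
  obtain ⟨M, hM⟩ := (isCompact_Icc (a := a) (b := b)).exists_bound_of_continuousOn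
    hV.continuousOn
  obtain ⟨B, hB⟩ := (isCompact_Icc (a := a) (b := b)).exists_bound_of_continuousOn
    hf.continuous_fst.continuousOn
  -- `K` bounds `V - lam i` once `|lam i| < |L| + 1`; `d` measures the initial error and `e` the
  -- forcing caused by the change of energy.
  set K := max 1 (M + (|L| + 1))
  have hK : 1 ≤ K := le_max_left _ _
  set d : ι → ℝ := fun i => |u i a - f a| + |v i a - g a|
  have hd : Tendsto d l (𝓝 0) := by
    simpa using (tendsto_sub_nhds_zero_iff.2 hua).abs.add (tendsto_sub_nhds_zero_iff.2 hva).abs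
  set e : ι → ℝ := fun i => |lam i - L| * |B|
  have he : Tendsto e l (𝓝 0) := by
    simpa using (tendsto_sub_nhds_zero_iff.2 hlam).abs.mul_const |B|
  have hbd : ∀ᶠ i in l, |lam i| < |L| + 1 :=
    hlam.abs.eventually_lt_const (by linarith)
  filter_upwards [(tendsto_gronwallBound_zero K (b - a) hd he).eventually_lt_const hε, hbd]
    with i hi hb t ht
  have h1 := ((hu i).abs_sub_le_gronwallBound hf (M := K) (ε := e i) (δ := d i) (a := a) (b := b)
    hK (fun s hs => ?_) (fun s hs => ?_) (by simp [d]) (by simp [d]) t ht).1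
  · refine h1.trans_lt (lt_of_le_of_lt ?_ hi)
    exact gronwallBound_mono (by positivity) (by positivity) (by linarith)
      (by linarith [ht.2])
  · refine (abs_sub _ _).trans ((add_le_add (hM s hs) hb.le).trans (le_max_right _ _))
  · have : V s - lam i - (V s - L) = - (lam i - L) := by ring
    rw [this, abs_neg]
    exact mul_le_mul_of_nonneg_left ((hB s hs).trans (le_abs_self B)) (abs_nonneg _)

theorem tendsto_of_tendsto_zero (hV : Continuous V)
    (hu : ∀ i, IsSol (fun t => V t - lam i) (u i) (v i)) (hf : IsSol (fun t => V t - L) f g)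
    (hlam : Tendsto lam l (𝓝 L)) (hua : Tendsto (fun i => u i 0) l (𝓝 (f 0)))
    (hva : Tendsto (fun i => v i 0) l (𝓝 (g 0))) (t : ℝ) :
    Tendsto (fun i => u i t) l (𝓝 (f t)) := by
  rw [Metric.tendsto_nhds]
  intro ε hε
  rcases le_total 0 t with ht | ht
  · filter_upwards [eventually_abs_sub_lt hV hu hf hlam hua hva (b := t) hε] with i hi
    exact hi t ⟨ht, le_rfl⟩
  · filter_upwards [eventually_abs_sub_lt (V := fun t => V (-t)) (hV.comp continuous_neg)
      (fun i => (hu i).comp_neg) hf.comp_neg hlam (a := 0) (b := -t) (by simpa using hua)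
      (by simpa using hva.neg) hε] with i hi
    simpa [Real.dist_eq] using hi (-t) ⟨by linarith, le_rfl⟩

end Family

/-! ### Construction of a positive bounded solution by exhaustion -/

/-- The lowest energy on `[-r, r]` with a Neumann condition at `-r` and a Dirichlet condition
at `r`. -/
theorem exists_mixed_ground_state {V : ℝ → ℝ} (hV : Continuous V) (hV0 : ∀ t, 0 ≤ V t) {M : ℝ}
    (hM : ∀ t ∈ Set.Icc (-1 : ℝ) 1, V t ≤ M) {r : ℝ} (hr : 1 ≤ r) :
    ∃ lam ∈ Set.Icc 0 (M + 3), ∃ u v : ℝ → ℝ, IsSol (fun t => V t - lam) u v ∧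
      (∀ t ∈ Set.Ioo (-r) r, 0 < u t) ∧ 0 ≤ u (-r) ∧ v (-r) = 0 ∧ u r = 0 := by
  choose U W hU hU0 hW0 using fun lam : ℝ =>
    exists_isSol (Q := fun t => V t - lam) (hV.sub continuous_const) (-r) 1 0
  -- Shooting from the Neumann data `(1, 0)` at `-r`: the sought eigenvalue is the supremum of the
  -- energies whose solution stays positive up to and including `r`.
  set S : Set ℝ := {lam | ∀ t ∈ Set.Icc (-r) r, 0 < U lam t} with hS
  have h0S : (0 : ℝ) ∈ S := fun t ht =>
    (hU 0).pos_of_nonneg_potential (fun t => by simpa using hV0 t) (hU0 0) (hW0 0) ht.1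
  -- Above `M + 3` one has `V - lam < -3 < -(π/2)²` on `[-1, 1]`, which excludes positivity there.
  have hSb : ∀ lam ∈ S, lam ≤ M + 3 := by
    intro lam hlam
    by_contra! hlt
    refine (hU lam).not_pos_of_le (fun t ht => ?_)
      fun t ht => hlam t ⟨by linarith [ht.1], by linarith [ht.2]⟩
    have := hM t ht
    nlinarith [Real.pi_lt_d2, Real.pi_pos]
  have hbdd : BddAbove S := ⟨M + 3, hSb⟩
  set L := sSup S with hL
  have hcont : ∀ ε > 0, ∀ᶠ lam in 𝓝 L, ∀ t ∈ Set.Icc (-r) r, |U lam t - U L t| < ε :=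
    fun ε hε => eventually_abs_sub_lt (lam := fun x => x) (u := U) (v := W) hV hU (hU L)
      tendsto_id (by simp [hU0]) (by simp [hW0]) hε
  have hfreq : ∃ᶠ lam in 𝓝 L, lam ∈ S :=
    mem_closure_iff_frequently.1 (csSup_mem_closure ⟨0, h0S⟩ hbdd)
  have hnonneg : ∀ t ∈ Set.Icc (-r) r, 0 ≤ U L t := by
    intro t ht
    by_contra! hneg
    obtain ⟨lam, hlamS, hlam⟩ := (hfreq.and_eventually (hcont (-U L t) (by linarith))).exists
    have h1 := hlamS t ht
    have h2 := (abs_lt.1 (hlam t ht)).2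
    linarith
  -- Positivity on a compact interval is an open condition in the energy, so a supremum inside `S`
  -- could be exceeded.
  have hnotS : L ∉ S := by
    intro hLS
    obtain ⟨t₀, ht₀, hmin⟩ := (isCompact_Icc (a := -r) (b := r)).exists_isMinOn
      ⟨0, by constructor <;> linarith⟩ (hU L).continuous_fst.continuousOn
    obtain ⟨δ, hδ, hball⟩ := Metric.eventually_nhds_iff.1 (hcont _ (hLS t₀ ht₀))
    have hmem : L + δ / 2 ∈ S := by
      intro t ht
      have h1 := (abs_lt.1 (hball (y := L + δ / 2)
        (by rw [Real.dist_eq, add_sub_cancel_left, abs_of_pos (by linarith)]; linarith) t ht)).1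
      have h2 := isMinOn_iff.1 hmin t ht
      linarith
    linarith [le_csSup hbdd hmem]
  have hQ : Continuous fun t => V t - L := hV.sub continuous_const
  have hpos : ∀ t ∈ Set.Ioo (-r) r, 0 < U L t := fun t ht =>
    (hU L).pos_of_nonneg hQ hnonneg (s := -r) (by rw [hU0]; norm_num) ht
  refine ⟨L, ⟨le_csSup hbdd h0S, csSup_le ⟨0, h0S⟩ hSb⟩, U L, W L, hU L, hpos,
    by rw [hU0]; norm_num, hW0 L, ?_⟩
  by_contra hne
  refine hnotS fun t ht => ?_
  rcases eq_or_lt_of_le ht.1 with h | h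
  · rw [← h, hU0]; norm_num
  rcases eq_or_lt_of_le ht.2 with h' | h'
  · rw [h'] at ht ⊢
    exact (hnonneg r ht).lt_of_ne' hne
  · exact hpos t ⟨h, h'⟩

/-- A confining potential has a bounded positive generalized eigenfunction. -/
theorem exists_bounded_positive_solution {V : ℝ → ℝ} (hV : Continuous V) (hV0 : ∀ t, 0 ≤ V t)
    (hVtop : ∀ C : ℝ, ∃ R : ℝ, ∀ t : ℝ, R ≤ |t| → C ≤ V t) :
    ∃ (L : ℝ) (f g : ℝ → ℝ), 0 ≤ L ∧ IsSol (fun t => V t - L) f g ∧ (∀ t, 0 < f t) ∧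
      ∃ B, ∀ t, f t ≤ B := by
  obtain ⟨M, hM⟩ := (isCompact_Icc (a := (-1 : ℝ)) (b := 1)).exists_bound_of_continuousOn
    hV.continuousOn
  choose lam hlam u v hu hpos hul hvl hur using fun n : ℕ =>
    exists_mixed_ground_state hV hV0 (fun t ht => (le_abs_self _).trans (hM t ht))
      (r := (n : ℝ) + 1) (by linarith [Nat.cast_nonneg (α := ℝ) n])
  have hu0 : ∀ n, 0 < u n 0 := fun n => hpos n 0
    ⟨by linarith [Nat.cast_nonneg (α := ℝ) n], by linarith [Nat.cast_nonneg (α := ℝ) n]⟩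
  -- Scaling the Cauchy data at `0` to norm one gives a convergent subsequence whose limit is again
  -- on the unit sphere, so the limiting solution is not identically zero.
  set c : ℕ → ℝ := fun n => ‖(u n 0, v n 0)‖⁻¹ with hc
  have hnorm : ∀ n, 0 < ‖(u n 0, v n 0)‖ := fun n =>
    norm_pos_iff.2 fun h => (hu0 n).ne' (congrArg Prod.fst h)
  have hc0 : ∀ n, 0 < c n := fun n => inv_pos.2 (hnorm n)
  set p : ℕ → ℝ × (ℝ × ℝ) := fun n => (lam n, (c n * u n 0, c n * v n 0))
  have hp : ∀ n, p n ∈ Set.Icc 0 (M + 3) ×ˢ Metric.sphere (0 : ℝ × ℝ) 1 := by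
    intro n
    refine ⟨hlam n, ?_⟩
    have : (c n * u n 0, c n * v n 0) = c n • (u n 0, v n 0) := rfl
    simp only [p, mem_sphere_zero_iff_norm, this, norm_smul, Real.norm_eq_abs]
    rw [abs_of_pos (hc0 n)]
    exact inv_mul_cancel₀ (hnorm n).ne'
  obtain ⟨⟨L, α, β⟩, hq, φ, hφ, hlim⟩ :=
    (isCompact_Icc.prod (isCompact_sphere (0 : ℝ × ℝ) 1)).tendsto_subseq hp
  have hL : Tendsto (fun k => lam (φ k)) atTop (𝓝 L) := (continuous_fst.tendsto _).comp hlim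
  have hα : Tendsto (fun k => c (φ k) * u (φ k) 0) atTop (𝓝 α) :=
    ((continuous_fst.comp continuous_snd).tendsto _).comp hlim
  have hβ : Tendsto (fun k => c (φ k) * v (φ k) 0) atTop (𝓝 β) :=
    ((continuous_snd.comp continuous_snd).tendsto _).comp hlim
  have hQ : Continuous fun t => V t - L := hV.sub continuous_const
  obtain ⟨f, g, hf, hf0, hg0⟩ := exists_isSol_zero hQ α β
  have hconv : ∀ t, Tendsto (fun k => c (φ k) * u (φ k) t) atTop (𝓝 (f t)) :=
    tendsto_of_tendsto_zero hV (fun k => (hu (φ k)).const_mul (c (φ k))) hf hL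
      (by simpa [hf0] using hα) (by simpa [hg0] using hβ)
  have hlarge : ∀ s : ℝ, ∀ᶠ k in atTop, s < (φ k : ℝ) + 1 := fun s =>
    (tendsto_atTop_add_const_right _ _
      (tendsto_natCast_atTop_atTop.comp hφ.tendsto_atTop)).eventually_gt_atTop s
  have hnn : ∀ n : ℕ, ∀ t ∈ Set.Icc (-((n : ℝ) + 1)) (n + 1), 0 ≤ u n t := by
    intro n t ht
    rcases eq_or_lt_of_le ht.1 with h | h
    · rw [← h]; exact hul n
    rcases eq_or_lt_of_le ht.2 with h' | h'
    · rw [h', hur]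
    · exact (hpos n t ⟨h, h'⟩).le
  have hfnn : ∀ t, 0 ≤ f t := by
    intro t
    refine ge_of_tendsto (hconv t) ?_
    filter_upwards [hlarge |t|] with k hk
    exact mul_nonneg (hc0 _).le (hnn _ t (abs_le.1 hk.le))
  have hex : ∃ s, 0 < f s := by
    by_contra! hall
    have hz : ∀ s, f s = 0 := fun s => le_antisymm (hall s) (hfnn s)
    have hf' : f = fun _ => 0 := funext hz
    have hg' : g 0 = 0 := (hf.fst 0).unique (by rw [hf']; exact hasDerivAt_const _ _)
    have := hq.2
    rw [← hf0, ← hg0, hz, hg'] at this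
    simp at this
  obtain ⟨s, hs⟩ := hex
  have hfpos : ∀ t, 0 < f t := fun t =>
    hf.pos_of_nonneg hQ (a := t - 1) (b := t + 1) (fun x _ => hfnn x) hs
      ⟨by linarith, by linarith⟩
  refine ⟨L, f, g, hq.1.1, hf, hfpos, ?_⟩
  -- All the energies `lam n` lie below `M + 3`, so beyond this one radius every approximant is
  -- convex and monotone, and the bound passes to the limit.
  obtain ⟨R, hR⟩ := hVtop (M + 3)
  set R' := max R 0
  have hR0 : 0 ≤ R' := le_max_right _ _
  have hQ0 : ∀ n t, R' ≤ |t| → 0 ≤ V t - lam n := fun n t ht => by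
    linarith [hR t ((le_max_left _ _).trans ht), (hlam n).2]
  have hright : ∀ t, R' ≤ t → f t ≤ f R' := by
    intro t ht
    refine le_of_tendsto_of_tendsto (hconv t) (hconv R') ?_
    filter_upwards [hlarge t] with k hk
    refine mul_le_mul_of_nonneg_left ?_ (hc0 _).le
    exact (hu (φ k)).antitoneOn_fst (a := R') (b := φ k + 1)
      (fun s hs => hQ0 _ s (hs.1.trans (le_abs_self s)))
      (fun s hs => hnn _ s ⟨by linarith [hs.1], hs.2⟩) (hur _)
      ⟨le_rfl, by linarith⟩ ⟨ht, hk.le⟩ ht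
  have hleft : ∀ t, t ≤ -R' → f t ≤ f (-R') := by
    intro t ht
    refine le_of_tendsto_of_tendsto (hconv t) (hconv (-R')) ?_
    filter_upwards [hlarge (-t)] with k hk
    refine mul_le_mul_of_nonneg_left ?_ (hc0 _).le
    exact (hu (φ k)).monotoneOn_fst (a := -((φ k : ℝ) + 1)) (b := -R')
      (fun s hs => hQ0 _ s (by linarith [neg_le_abs s, hs.2]))
      (fun s hs => hnn _ s ⟨hs.1, by linarith [hs.2]⟩) (hvl _).ge
      ⟨by linarith, ht⟩ ⟨by linarith, le_rfl⟩ ht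
  obtain ⟨B, hB⟩ := (isCompact_Icc (a := -R') (b := R')).exists_bound_of_continuousOn
    hf.continuous_fst.continuousOn
  have hB' : ∀ t ∈ Set.Icc (-R') R', f t ≤ B := fun t ht => (le_abs_self _).trans (hB t ht)
  refine ⟨B, fun t => ?_⟩
  rcases le_total R' t with h | h
  · exact (hright t h).trans (hB' _ ⟨by linarith, le_rfl⟩)
  rcases le_total t (-R') with h' | h'
  · exact (hleft t h').trans (hB' _ ⟨le_rfl, by linarith⟩)
  · exact hB' t ⟨h', h⟩

/-! ### Decay of positive solutions and bounds on the logarithmic derivative -/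

namespace IsSol

variable {Q f g : ℝ → ℝ}

/-- A bounded positive solution decays exponentially in a forbidden region. -/
theorem add_nonpos_of_bounded (h : IsSol Q f g) {B R : ℝ} (hf : ∀ t, 0 < f t)
    (hB : ∀ t, f t ≤ B) (hQ : ∀ t, R ≤ t → 1 ≤ Q t) {t : ℝ} (ht : R ≤ t) : f t + g t ≤ 0 := by
  by_contra! hpos
  set p := f t + g t
  have hB0 : 0 < B := (hf 0).trans_le (hB 0)
  -- Since `(f + g)' = (f + g) + (Q - 1) f`, a positive value of `f + g` grows exponentially; as `f`
  -- is bounded, the growth falls on `g = f'`.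
  have hd : ∀ s, HasDerivAt (fun s => Real.exp (-s) * (f s + g s))
      (Real.exp (-s) * ((Q s - 1) * f s)) s := by
    intro s
    have := (hasDerivAt_neg s).exp.mul ((h.fst s).add (h.snd s))
    exact this.congr_deriv (by simp only [Pi.add_apply]; ring)
  have hmono : MonotoneOn (fun s => Real.exp (-s) * (f s + g s)) (Set.Ici t) := by
    refine monotoneOn_of_deriv_nonneg (convex_Ici t)
      (fun s _ => (hd s).continuousAt.continuousWithinAt)
      (fun s _ => (hd s).differentiableAt.differentiableWithinAt) fun s hs => ?_
    rw [interior_Ici] at hs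
    rw [(hd s).deriv]
    have := hQ s (ht.trans (le_of_lt hs))
    have := hf s
    exact mul_nonneg (Real.exp_pos _).le (mul_nonneg (by linarith) this.le)
  have hgrow : ∀ s, t ≤ s → p * (1 + (s - t)) ≤ f s + g s := by
    intro s hs
    have h1 := hmono (Set.mem_Ici.2 le_rfl) (Set.mem_Ici.2 hs) hs
    simp only at h1
    have h2 : p * Real.exp (s - t) ≤ f s + g s := by
      have := mul_le_mul_of_nonneg_left h1 (Real.exp_pos s).le
      rw [← mul_assoc, ← mul_assoc, ← Real.exp_add, ← Real.exp_add, add_neg_cancel,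
        Real.exp_zero, one_mul, ← sub_eq_add_neg, mul_comm] at this
      exact this
    refine le_trans ?_ h2
    have := Real.add_one_le_exp (s - t)
    nlinarith
  -- Past `t₁` the sum `f + g` exceeds `B + 1`, so `g ≥ 1`; over a further length `B` the function
  -- `f` would then rise above `B`.
  set t₁ := t + (B + 1) / p
  have ht₁ : t ≤ t₁ := by simp only [t₁]; linarith [div_pos (by linarith : 0 < B + 1) hpos]
  have hg1 : ∀ s, t₁ ≤ s → 1 ≤ g s := by
    intro s hs
    have h1 := hgrow s (ht₁.trans hs)
    have h2 : B + 1 ≤ p * (s - t) := by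
      have : (B + 1) / p ≤ s - t := by simp only [t₁] at hs; linarith
      rwa [div_le_iff₀' hpos] at this
    nlinarith [hB s]
  have h3 := (convex_Ici t₁).mul_sub_le_image_sub_of_le_deriv (C := 1) (f := f)
    h.continuous_fst.continuousOn (fun s _ => (h.fst s).differentiableAt.differentiableWithinAt)
    (fun s hs => by
      rw [interior_Ici] at hs
      rw [(h.fst s).deriv]
      exact hg1 s (le_of_lt hs))
    t₁ (Set.mem_Ici.2 le_rfl) (t₁ + B) (Set.mem_Ici.2 (by linarith)) (by linarith)
  linarith [hf t₁, hB (t₁ + B)]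

/-- The inequality `f + f' ≤ 0` says that `exp t * f t` is nonincreasing. -/
theorem le_mul_exp_right (h : IsSol Q f g) {B R : ℝ} (hf : ∀ t, 0 < f t)
    (hB : ∀ t, f t ≤ B) (hQ : ∀ t, R ≤ t → 1 ≤ Q t) {t : ℝ} (ht : R ≤ t) :
    f t ≤ B * Real.exp (R - t) := by
  have hd : ∀ s, HasDerivAt (fun s => Real.exp s * f s) (Real.exp s * (f s + g s)) s := by
    intro s
    exact ((Real.hasDerivAt_exp s).mul (h.fst s)).congr_deriv (by ring)
  have hanti : AntitoneOn (fun s => Real.exp s * f s) (Set.Ici R) := by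
    refine antitoneOn_of_deriv_nonpos (convex_Ici R)
      (fun s _ => (hd s).continuousAt.continuousWithinAt)
      (fun s _ => (hd s).differentiableAt.differentiableWithinAt) fun s hs => ?_
    rw [interior_Ici] at hs
    rw [(hd s).deriv]
    exact mul_nonpos_of_nonneg_of_nonpos (Real.exp_pos _).le
      (h.add_nonpos_of_bounded hf hB hQ (le_of_lt hs))
  have h1 := hanti (Set.mem_Ici.2 le_rfl) (Set.mem_Ici.2 ht) ht
  simp only at h1
  rw [sub_eq_add_neg, Real.exp_add, Real.exp_neg, ← mul_assoc, ← div_eq_mul_inv,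
    le_div_iff₀ (Real.exp_pos t)]
  nlinarith [hB R, Real.exp_pos R]

/-- By convexity the drop of `f` over `[t - 1, t]` is at least `-g t`, and this drop is at most `f
(t - 1)`. -/
theorem abs_snd_le_mul_exp_right (h : IsSol Q f g) {B R : ℝ} (hf : ∀ t, 0 < f t)
    (hB : ∀ t, f t ≤ B) (hQ : ∀ t, R ≤ t → 1 ≤ Q t) {t : ℝ} (ht : R + 1 ≤ t) :
    |g t| ≤ B * Real.exp (R + 1 - t) := by
  have hneg : g t ≤ 0 := by linarith [h.add_nonpos_of_bounded hf hB hQ (t := t) (by linarith), hf t]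
  have hm : MonotoneOn g (Set.Icc (t - 1) t) :=
    h.monotoneOn_snd (fun s hs => by linarith [hQ s (by linarith [hs.1])]) fun s _ => (hf s).le
  have h3 := (convex_Icc (t - 1) t).image_sub_le_mul_sub_of_deriv_le (C := g t) (f := f)
    h.continuous_fst.continuousOn (fun s _ => (h.fst s).differentiableAt.differentiableWithinAt)
    (fun s hs => by
      have hs' := interior_subset hs
      rw [(h.fst s).deriv]
      exact hm hs' ⟨by linarith, le_rfl⟩ hs'.2)
    (t - 1) ⟨le_rfl, by linarith⟩ t ⟨by linarith, le_rfl⟩ (by linarith)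
  have h4 := h.le_mul_exp_right hf hB hQ (t := t - 1) (by linarith)
  rw [show R - (t - 1) = R + 1 - t by ring] at h4
  rw [abs_of_nonpos hneg]
  linarith [hf t]

theorem le_mul_exp_abs (h : IsSol Q f g) {B R : ℝ} (hf : ∀ t, 0 < f t)
    (hB : ∀ t, f t ≤ B) (hQ : ∀ t, R ≤ |t| → 1 ≤ Q t) (t : ℝ) :
    f t ≤ B * Real.exp R * Real.exp (-|t|) := by
  have hB0 : 0 < B := (hf 0).trans_le (hB 0)
  rw [mul_assoc, ← Real.exp_add, ← sub_eq_add_neg]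
  rcases lt_or_ge |t| R with htR | htR
  · refine (hB t).trans (le_mul_of_one_le_right hB0.le (Real.one_le_exp (by linarith)))
  rcases le_total 0 t with ht | ht
  · rw [abs_of_nonneg ht] at htR ⊢
    exact h.le_mul_exp_right hf hB (fun s hs => hQ s (hs.trans (le_abs_self s))) htR
  · rw [abs_of_nonpos ht] at htR ⊢
    simpa using h.comp_neg.le_mul_exp_right (R := R) (fun s => hf _) (fun s => hB _)
      (fun s hs => hQ _ (by rw [abs_neg]; exact hs.trans (le_abs_self s))) htR

theorem exists_abs_snd_le_mul_exp_abs (h : IsSol Q f g) {B R : ℝ} (hf : ∀ t, 0 < f t)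
    (hB : ∀ t, f t ≤ B) (hQ : ∀ t, R ≤ |t| → 1 ≤ Q t) :
    ∃ C, ∀ t, |g t| ≤ C * Real.exp (-|t|) := by
  obtain ⟨M, hM⟩ := (isCompact_Icc (a := -(R + 1)) (b := R + 1)).exists_bound_of_continuousOn
    h.continuous_snd.continuousOn
  refine ⟨max M B * Real.exp (R + 1), fun t => ?_⟩
  have hB0 : 0 < B := (hf 0).trans_le (hB 0)
  rw [mul_assoc, ← Real.exp_add, ← sub_eq_add_neg]
  have hmax : B * Real.exp (R + 1 - |t|) ≤ max M B * Real.exp (R + 1 - |t|) :=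
    mul_le_mul_of_nonneg_right (le_max_right _ _) (Real.exp_pos _).le
  rcases le_or_gt |t| (R + 1) with htR | htR
  · refine ((hM t (abs_le.1 htR)).trans (le_max_left M B)).trans
      (le_mul_of_one_le_right (hB0.le.trans (le_max_right _ _)) (Real.one_le_exp (by linarith)))
  refine le_trans ?_ hmax
  rcases le_total 0 t with ht | ht
  · rw [abs_of_nonneg ht] at htR ⊢
    exact h.abs_snd_le_mul_exp_right hf hB (fun s hs => hQ s (hs.trans (le_abs_self s))) htR.le
  · rw [abs_of_nonpos ht] at htR ⊢
    simpa using h.comp_neg.abs_snd_le_mul_exp_right (R := R) (fun s => hf _) (fun s => hB _)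
      (fun s hs => hQ _ (by rw [abs_neg]; exact hs.trans (le_abs_self s))) htR.le

/-- A positive solution cannot decay faster than a Gaussian. -/
theorem neg_mul_le_snd (h : IsSol Q f g) {C : ℝ} (hC : 0 ≤ C) (hf : ∀ t, 0 < f t)
    (hQ : ∀ t, 0 ≤ t → Q t + 1 ≤ (C + t) ^ 2) {t : ℝ} (ht : 0 ≤ t) : -(C + t) * f t ≤ g t := by
  by_contra! hlt
  -- `p' = (C + s) p + (Q + 1 - (C + s)²) f`, and the last term is nonpositive by `hQ`. So once `p`
  -- is negative it stays negative and decreases.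
  set p : ℝ → ℝ := fun s => g s + (C + s) * f s with hp
  have hp0 : p t < 0 := by simp only [p]; linarith
  have hpd : ∀ s, HasDerivAt p ((C + s) * p s + (Q s + 1 - (C + s) ^ 2) * f s) s := by
    intro s
    have := (h.snd s).add (((hasDerivAt_id s).const_add C).mul (h.fst s))
    exact this.congr_deriv (by simp only [hp, id]; ring)
  have hed : ∀ s, HasDerivAt (fun s => Real.exp (-(C * s + s ^ 2 / 2)) * p s)
      (Real.exp (-(C * s + s ^ 2 / 2)) * ((Q s + 1 - (C + s) ^ 2) * f s)) s := by
    intro s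
    have h1 : HasDerivAt (fun s : ℝ => -(C * s + s ^ 2 / 2)) (-(C + s)) s := by
      have := (((hasDerivAt_id s).const_mul C).add (((hasDerivAt_id s).fun_pow 2).div_const 2)).neg
      exact this.congr_deriv (by simp only [id]; push_cast; ring)
    exact (h1.exp.mul (hpd s)).congr_deriv (by ring)
  have hneg : ∀ s, t ≤ s → p s < 0 := by
    intro s hs
    have hanti : AntitoneOn (fun s => Real.exp (-(C * s + s ^ 2 / 2)) * p s) (Set.Ici t) := by
      refine antitoneOn_of_deriv_nonpos (convex_Ici t)
        (fun s _ => (hed s).continuousAt.continuousWithinAt)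
        (fun s _ => (hed s).differentiableAt.differentiableWithinAt) fun s hs => ?_
      rw [interior_Ici] at hs
      rw [(hed s).deriv]
      exact mul_nonpos_of_nonneg_of_nonpos (Real.exp_pos _).le
        (mul_nonpos_of_nonpos_of_nonneg (by linarith [hQ s (ht.trans (le_of_lt hs))]) (hf s).le)
    have h1 := hanti (Set.mem_Ici.2 le_rfl) (Set.mem_Ici.2 hs) hs
    have h2 : Real.exp (-(C * t + t ^ 2 / 2)) * p t < 0 :=
      mul_neg_of_pos_of_neg (Real.exp_pos _) hp0
    exact (pos_iff_neg_of_mul_neg (h1.trans_lt h2)).1 (Real.exp_pos _)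
  have hpanti : AntitoneOn p (Set.Ici t) := by
    refine antitoneOn_of_deriv_nonpos (convex_Ici t)
      (fun s _ => (hpd s).continuousAt.continuousWithinAt)
      (fun s _ => (hpd s).differentiableAt.differentiableWithinAt) fun s hs => ?_
    rw [interior_Ici] at hs
    have hs' : t ≤ s := le_of_lt hs
    rw [(hpd s).deriv]
    have h1 := mul_nonneg_of_nonpos_of_nonpos
      (by linarith [hQ s (ht.trans hs')] : Q s + 1 - (C + s) ^ 2 ≤ 0)
      (neg_nonpos.2 (hf s).le)
    have h2 := mul_nonneg (by linarith : 0 ≤ C + s) (neg_nonneg.2 (hneg s hs').le)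
    nlinarith
  have hgle : ∀ s, t ≤ s → g s ≤ p t := by
    intro s hs
    have h1 := hpanti (Set.mem_Ici.2 le_rfl) (Set.mem_Ici.2 hs) hs
    have h2 := mul_nonneg (by linarith : 0 ≤ C + s) (hf s).le
    simp only [hp] at h1 ⊢
    linarith
  -- With slope at most `p t < 0` from `t` on, `f` would reach zero no later than at this point.
  set s := t + f t / (-p t)
  have hts : t ≤ s := by simp only [s]; linarith [div_pos (hf t) (by linarith : 0 < -p t)]
  have h3 := (convex_Ici t).image_sub_le_mul_sub_of_deriv_le (C := p t) (f := f)
    h.continuous_fst.continuousOn (fun s _ => (h.fst s).differentiableAt.differentiableWithinAt)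
    (fun s hs => by
      rw [interior_Ici] at hs
      rw [(h.fst s).deriv]
      exact hgle s (le_of_lt hs))
    t (Set.mem_Ici.2 le_rfl) s (Set.mem_Ici.2 hts) hts
  have h4 : p t * (s - t) = - f t := by
    have : p t ≠ 0 := hp0.ne
    simp only [s]
    field_simp
    ring
  linarith [hf s]

end IsSol

/-! ### Integrability of exponentially decaying functions -/

theorem one_add_abs_sq_le (t : ℝ) : (1 + |t|) ^ 2 ≤ 2 * Real.exp |t| := by
  nlinarith [abs_nonneg t, Real.quadratic_le_exp_of_nonneg (abs_nonneg t)]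

theorem integrable_exp_neg_abs : Integrable fun t : ℝ => Real.exp (-|t|) := by
  refine (integrable_inv_one_add_sq.const_mul 2).mono'
    (by fun_prop : Continuous _).aestronglyMeasurable (ae_of_all _ fun t => ?_)
  rw [Real.norm_eq_abs, Real.abs_exp, Real.exp_neg, ← div_eq_mul_inv,
    inv_eq_one_div, div_le_div_iff₀ (Real.exp_pos _) (by positivity)]
  nlinarith [one_add_abs_sq_le t, sq_abs t, abs_nonneg t]

/-- One of the two exponentials absorbs the quadratic weight and the other remains as an integrable
majorant. -/
theorem abs_weight_mul_le {w f g t B C K : ℝ} (hB : |f| ≤ B * Real.exp (-|t|))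
    (hC : |g| ≤ C * Real.exp (-|t|)) (hK : |w| ≤ K * (1 + |t|) ^ 2) :
    |w * (f * g)| ≤ 2 * K * (B * C) * Real.exp (-|t|) := by
  have hB0' : 0 ≤ B := nonneg_of_mul_nonneg_left ((abs_nonneg _).trans hB) (Real.exp_pos _)
  have hC0' : 0 ≤ C := nonneg_of_mul_nonneg_left ((abs_nonneg _).trans hC) (Real.exp_pos _)
  have hK0' : 0 ≤ K := nonneg_of_mul_nonneg_left ((abs_nonneg _).trans hK) (by positivity)
  rw [abs_mul, abs_mul]
  calc |w| * (|f| * |g|)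
      ≤ K * (2 * Real.exp |t|) * ((B * Real.exp (-|t|)) * (C * Real.exp (-|t|))) := by
        gcongr
        exact hK.trans (mul_le_mul_of_nonneg_left (one_add_abs_sq_le t) hK0')
    _ = 2 * K * (B * C) * (Real.exp |t| * Real.exp (-|t|)) * Real.exp (-|t|) := by ring
    _ = _ := by rw [← Real.exp_add, add_neg_cancel, Real.exp_zero, mul_one]

/-- Products of two exponentially decaying functions are integrable against quadratic weights. -/
theorem integrable_weight_mul {f g w : ℝ → ℝ} (hw : Continuous w) (hf : Continuous f)
    (hg : Continuous g) {B C K : ℝ} (hB : ∀ t, |f t| ≤ B * Real.exp (-|t|))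
    (hC : ∀ t, |g t| ≤ C * Real.exp (-|t|)) (hK : ∀ t, |w t| ≤ K * (1 + |t|) ^ 2) :
    Integrable fun t => w t * (f t * g t) :=
  (integrable_exp_neg_abs.const_mul (2 * K * (B * C))).mono'
    (hw.mul (hf.mul hg)).aestronglyMeasurable
    (ae_of_all _ fun t => abs_weight_mul_le (hB t) (hC t) (hK t))

theorem integrable_mul_of_decay {f g : ℝ → ℝ} (hf : Continuous f) (hg : Continuous g) {B C : ℝ}
    (hB : ∀ t, |f t| ≤ B * Real.exp (-|t|)) (hC : ∀ t, |g t| ≤ C * Real.exp (-|t|)) :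
    Integrable fun t => f t * g t := by
  simpa using integrable_weight_mul (w := fun _ => 1) continuous_const hf hg hB hC (K := 1)
    (fun t => by rw [abs_one, one_mul]; nlinarith [abs_nonneg t])

theorem tendsto_weight_mul_cocompact {f g w : ℝ → ℝ} {B C K : ℝ}
    (hB : ∀ t, |f t| ≤ B * Real.exp (-|t|))
    (hC : ∀ t, |g t| ≤ C * Real.exp (-|t|)) (hK : ∀ t, |w t| ≤ K * (1 + |t|) ^ 2) :
    Tendsto (fun t => w t * (f t * g t)) (cocompact ℝ) (𝓝 0) := by
  have h : Tendsto (fun t : ℝ => Real.exp (-|t|)) (cocompact ℝ) (𝓝 0) :=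
    Real.tendsto_exp_neg_atTop_nhds_zero.comp (tendsto_norm_cocompact_atTop (E := ℝ))
  exact squeeze_zero_norm (fun t => abs_weight_mul_le (hB t) (hC t) (hK t))
    (by simpa using h.const_mul (2 * K * (B * C)))

theorem tendsto_mul_cocompact_of_decay {f g : ℝ → ℝ} {B C : ℝ}
    (hB : ∀ t, |f t| ≤ B * Real.exp (-|t|)) (hC : ∀ t, |g t| ≤ C * Real.exp (-|t|)) :
    Tendsto (fun t => f t * g t) (cocompact ℝ) (𝓝 0) := by
  simpa using tendsto_weight_mul_cocompact (w := fun _ => 1) hB hC (K := 1)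
    (fun t => by rw [abs_one, one_mul]; nlinarith [abs_nonneg t])

/-! ### The step potential -/

/-- The piecewise linear field profile, so that `V_a(ξ, t) = (ξ + profile a t)²`. -/
noncomputable def profile (a t : ℝ) : ℝ := if t < 0 then a * t else t

theorem profile_eq (a t : ℝ) : profile a t = max t 0 + a * min t 0 := by
  unfold profile
  split_ifs with h
  · rw [max_eq_right h.le, min_eq_left h.le, zero_add]
  · rw [max_eq_left (not_lt.1 h), min_eq_right (not_lt.1 h), mul_zero, add_zero]

theorem continuous_profile (a : ℝ) : Continuous (profile a) := by
  have : profile a = fun t => max t 0 + a * min t 0 := funext (profile_eq a)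
  rw [this]
  fun_prop

theorem potential_eq (a ξ t : ℝ) : potential a ξ t = (ξ + profile a t) ^ 2 := by
  unfold potential profile
  split_ifs <;> rfl

theorem continuous_potential (a ξ : ℝ) : Continuous (potential a ξ) := by
  have : potential a ξ = fun t => (ξ + profile a t) ^ 2 := funext (potential_eq a ξ)
  rw [this]
  exact (continuous_const.add (continuous_profile a)).pow 2

theorem potential_nonneg (a ξ t : ℝ) : 0 ≤ potential a ξ t := by
  rw [potential_eq]; positivity

/-- The expansion in `η - ξ` is exact, with quadratic coefficient `1`; this is what makes the
Rayleigh comparison of two parameters explicit. -/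
theorem potential_add (a ξ η t : ℝ) : potential a η t =
    potential a ξ t + (η - ξ) * (2 * (ξ + profile a t)) + (η - ξ) ^ 2 := by
  rw [potential_eq, potential_eq]; ring

section Bounds

variable {a : ℝ} (ha : a ∈ Set.Ico (-1 : ℝ) 0)
include ha

theorem abs_profile_le (t : ℝ) : |profile a t| ≤ |t| := by
  unfold profile
  split_ifs with h
  · rw [abs_mul, abs_of_neg ha.2]
    nlinarith [ha.1, abs_nonneg t]
  · exact le_rfl

theorem mul_abs_le_abs_profile (t : ℝ) : |a| * |t| ≤ |profile a t| := by
  unfold profile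
  split_ifs with h
  · rw [abs_mul]
  · rw [abs_of_neg ha.2]
    nlinarith [ha.1, abs_nonneg t]

/-- `|ξ + profile a t| ≥ C + 1` and `C ≤ (C + 1)²`. The threshold depends on `ξ` only through `|ξ|`,
which later yields decay uniform in the parameter. -/
theorem le_potential {ξ C t : ℝ} (hC : 0 ≤ C) (h : C + 1 + |ξ| ≤ |a| * |t|) :
    C ≤ potential a ξ t := by
  rw [potential_eq, ← sq_abs]
  have h1 : |profile a t| - |ξ| ≤ |ξ + profile a t| := by
    have := abs_sub_abs_le_abs_sub (profile a t) (-ξ)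
    rwa [abs_neg, sub_neg_eq_add, add_comm (profile a t)] at this
  have h2 := mul_abs_le_abs_profile ha t
  nlinarith

theorem exists_le_potential (ξ C : ℝ) : ∃ R : ℝ, ∀ t : ℝ, R ≤ |t| → C ≤ potential a ξ t := by
  have ha0 : 0 < |a| := abs_pos.2 ha.2.ne
  refine ⟨(|C| + 1 + |ξ|) / |a|, fun t ht => (le_abs_self C).trans ?_⟩
  exact le_potential ha (abs_nonneg C) (by rwa [div_le_iff₀' ha0] at ht)

theorem potential_le (ξ t : ℝ) : potential a ξ t ≤ (|ξ| + |t|) ^ 2 := by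
  rw [potential_eq, ← sq_abs]
  have := (abs_add_le ξ (profile a t)).trans (add_le_add_right (abs_profile_le ha t) _)
  gcongr

theorem abs_potential_le (ξ t : ℝ) : |potential a ξ t| ≤ (|ξ| + 1) ^ 2 * (1 + |t|) ^ 2 := by
  rw [abs_of_nonneg (potential_nonneg _ _ _), ← mul_pow]
  refine (potential_le ha ξ t).trans (pow_le_pow_left₀ (by positivity) ?_ 2)
  nlinarith [abs_nonneg ξ, abs_nonneg t, mul_nonneg (abs_nonneg ξ) (abs_nonneg t)]

theorem abs_two_mul_add_profile_le (ξ t : ℝ) :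
    |2 * (ξ + profile a t)| ≤ 2 * (|ξ| + 1) * (1 + |t|) ^ 2 := by
  rw [abs_mul, abs_two, mul_assoc]
  have h := (abs_add_le ξ (profile a t)).trans (add_le_add_right (abs_profile_le ha t) _)
  have h1 := abs_nonneg ξ
  have h2 := abs_nonneg t
  have h3 : |ξ| + |t| ≤ (|ξ| + 1) * (1 + |t|) ^ 2 := by
    nlinarith [mul_nonneg h1 h2, mul_nonneg h1 (sq_nonneg |t|), sq_nonneg |t|]
  linarith

end Bounds

/-! ### Normalized ground states and their integral identities -/

/-- `f` is a positive normalized solution of `-f'' + V_a(ξ, ·) f = L f` with `f' = g`, and `f`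
and `g` decay exponentially. -/
structure IsGround (a ξ L : ℝ) (f g : ℝ → ℝ) : Prop where
  sol : IsSol (fun t => potential a ξ t - L) f g
  pos : ∀ t, 0 < f t
  norm : ∫ t, f t ^ 2 = 1
  nonneg : 0 ≤ L
  decay : ∃ B, (∀ t, |f t| ≤ B * Real.exp (-|t|)) ∧ ∀ t, |g t| ≤ B * Real.exp (-|t|)

theorem exists_isGround {a : ℝ} (ha : a ∈ Set.Ico (-1 : ℝ) 0) (ξ : ℝ) :
    ∃ (L : ℝ) (f g : ℝ → ℝ), IsGround a ξ L f g := by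
  obtain ⟨L, f, g, hL, hs, hpos, B, hB⟩ := exists_bounded_positive_solution
    (continuous_potential a ξ) (potential_nonneg a ξ) (exists_le_potential ha ξ)
  obtain ⟨R, hR⟩ := exists_le_potential ha ξ (L + 1)
  have hQ : ∀ t, R ≤ |t| → 1 ≤ potential a ξ t - L := fun t ht => by linarith [hR t ht]
  have hf : ∀ t, |f t| ≤ B * Real.exp R * Real.exp (-|t|) := fun t => by
    rw [abs_of_pos (hpos t)]
    exact hs.le_mul_exp_abs hpos hB hQ t
  obtain ⟨C, hC⟩ := hs.exists_abs_snd_le_mul_exp_abs hpos hB hQ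
  have hint : Integrable fun t => f t ^ 2 := by
    simpa only [sq] using integrable_mul_of_decay hs.continuous_fst hs.continuous_fst hf hf
  have hI : 0 < ∫ t, f t ^ 2 := by
    rw [integral_pos_iff_support_of_nonneg (fun t => sq_nonneg _) hint]
    have : Function.support (fun t => f t ^ 2) = Set.univ :=
      Set.eq_univ_of_forall fun t => (pow_pos (hpos t) 2).ne'
    simp [this]
  set c := (√(∫ t, f t ^ 2))⁻¹ with hc
  have hc0 : 0 < c := inv_pos.2 (Real.sqrt_pos.2 hI)
  refine ⟨L, fun t => c * f t, fun t => c * g t, hs.const_mul c, fun t => mul_pos hc0 (hpos t),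
    ?_, hL, c * max (B * Real.exp R) C, fun t => ?_, fun t => ?_⟩
  · simp only [mul_pow]
    rw [integral_const_mul, hc, inv_pow, Real.sq_sqrt hI.le]
    exact inv_mul_cancel₀ hI.ne'
  · rw [abs_mul, abs_of_pos hc0, mul_assoc]
    have h1 := mul_le_mul_of_nonneg_right (le_max_left (B * Real.exp R) C) (Real.exp_pos (-|t|)).le
    exact mul_le_mul_of_nonneg_left ((hf t).trans h1) hc0.le
  · rw [abs_mul, abs_of_pos hc0, mul_assoc]
    have h1 := mul_le_mul_of_nonneg_right (le_max_right (B * Real.exp R) C) (Real.exp_pos (-|t|)).le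
    exact mul_le_mul_of_nonneg_left ((hC t).trans h1) hc0.le

namespace IsGround

variable {a ξ L : ℝ} {f g : ℝ → ℝ}

theorem integrable_sq_fst (h : IsGround a ξ L f g) : Integrable fun t => f t ^ 2 := by
  obtain ⟨B, hf, hg⟩ := h.decay
  simpa only [sq] using
    integrable_mul_of_decay h.sol.continuous_fst h.sol.continuous_fst hf hf

theorem integrable_sq_snd (h : IsGround a ξ L f g) : Integrable fun t => g t ^ 2 := by
  obtain ⟨B, hf, hg⟩ := h.decay
  simpa only [sq] using
    integrable_mul_of_decay h.sol.continuous_snd h.sol.continuous_snd hg hg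

theorem integrable_weight (h : IsGround a ξ L f g) {w : ℝ → ℝ} (hw : Continuous w) {K : ℝ}
    (hK : ∀ t, |w t| ≤ K * (1 + |t|) ^ 2) : Integrable fun t => w t * f t ^ 2 := by
  obtain ⟨B, hf, hg⟩ := h.decay
  simpa only [sq] using
    integrable_weight_mul hw h.sol.continuous_fst h.sol.continuous_fst hf hf hK

theorem integrable_potential (ha : a ∈ Set.Ico (-1 : ℝ) 0) (h : IsGround a ξ L f g) (η : ℝ) :
    Integrable fun t => potential a η t * f t ^ 2 :=
  h.integrable_weight (continuous_potential a η) (abs_potential_le ha η)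

theorem integrable_profile (ha : a ∈ Set.Ico (-1 : ℝ) 0) (h : IsGround a ξ L f g) (η : ℝ) :
    Integrable fun t => 2 * (η + profile a t) * f t ^ 2 :=
  h.integrable_weight (continuous_const.mul (continuous_const.add (continuous_profile a)))
    (abs_two_mul_add_profile_le ha η)

/-- `(f g)' = g² + (V - L) f²`, and `f g` vanishes at both infinities. -/
theorem integral_energy (ha : a ∈ Set.Ico (-1 : ℝ) 0) (h : IsGround a ξ L f g) :
    ∫ t, (g t ^ 2 + potential a ξ t * f t ^ 2) = L := by
  obtain ⟨B, hf, hg⟩ := h.decay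
  have hi1 := h.integrable_sq_snd.add (h.integrable_potential ha ξ)
  have hi2 := h.integrable_sq_fst.const_mul L
  have ht := tendsto_mul_cocompact_of_decay hf hg
  have key := integral_of_hasDerivAt_of_tendsto
    (f := fun t => f t * g t) (f' := fun t => g t ^ 2 + potential a ξ t * f t ^ 2 - L * f t ^ 2)
    (fun t => ((h.sol.fst t).mul (h.sol.snd t)).congr_deriv (by ring)) (hi1.sub hi2)
    (ht.mono_left atBot_le_cocompact) (ht.mono_left atTop_le_cocompact)
  rw [integral_sub (by exact hi1) hi2, integral_const_mul, h.norm] at key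
  linarith

theorem integral_energy_add (ha : a ∈ Set.Ico (-1 : ℝ) 0) (h : IsGround a ξ L f g) (η : ℝ) :
    ∫ t, (g t ^ 2 + potential a η t * f t ^ 2) =
      L + (η - ξ) * (∫ t, 2 * (ξ + profile a t) * f t ^ 2) + (η - ξ) ^ 2 := by
  have : (fun t => g t ^ 2 + potential a η t * f t ^ 2) = fun t =>
      (g t ^ 2 + potential a ξ t * f t ^ 2) + ((η - ξ) * (2 * (ξ + profile a t) * f t ^ 2) +
        (η - ξ) ^ 2 * f t ^ 2) := by
    funext t
    rw [potential_add a ξ η t]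
    ring
  have hi1 := h.integrable_sq_snd.add (h.integrable_potential ha ξ)
  have hi2 := (h.integrable_profile ha ξ).const_mul (η - ξ)
  have hi3 := h.integrable_sq_fst.const_mul ((η - ξ) ^ 2)
  rw [this, integral_add (by exact hi1) (by exact hi2.add hi3), integral_add hi2 hi3,
    h.integral_energy ha, integral_const_mul, integral_const_mul, h.norm]
  ring

/-- The Feynman–Hellmann integral in terms of boundary data at the jump. -/
theorem integral_profile (ha : a ∈ Set.Ico (-1 : ℝ) 0) (h : IsGround a ξ L f g) :
    ∫ t, 2 * (ξ + profile a t) * f t ^ 2 =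
      (1 - 1 / a) * (g 0 ^ 2 + (L - ξ ^ 2) * f 0 ^ 2) := by
  obtain ⟨B, hf, hg⟩ := h.decay
  have hint := h.integrable_profile ha ξ
  -- The terms with `f g` cancel in `P'`, leaving `-(∂_t V) f²`. `P` is continuous across `0`
  -- although `∂_t V` may jump there, so both half-lines see the same value `P 0`.
  set P : ℝ → ℝ := fun t => g t ^ 2 - (potential a ξ t - L) * f t ^ 2 with hP
  have hPlim : Tendsto P (cocompact ℝ) (𝓝 0) := by
    have h1 := (tendsto_mul_cocompact_of_decay hg hg).sub ((tendsto_weight_mul_cocompact hf hf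
      (abs_potential_le ha ξ)).sub ((tendsto_mul_cocompact_of_decay hf hf).const_mul L))
    simp only [mul_zero, sub_zero] at h1
    exact h1.congr fun t => by simp only [hP]; ring
  have hPd : ∀ t d, HasDerivAt (potential a ξ) d t → HasDerivAt P (-(d * f t ^ 2)) t := by
    intro t d hd
    have := ((h.sol.snd t).fun_pow 2).sub ((hd.sub_const L).mul ((h.sol.fst t).fun_pow 2))
    exact this.congr_deriv (by push_cast; ring)
  have hPc : Continuous P := (h.sol.continuous_snd.pow 2).sub
    (((continuous_potential a ξ).sub continuous_const).mul (h.sol.continuous_fst.pow 2))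
  have hP0 : P 0 = g 0 ^ 2 + (L - ξ ^ 2) * f 0 ^ 2 := by
    simp only [hP, potential_eq, profile, lt_irrefl, if_false]
    ring
  have hright : ∫ t in Set.Ioi 0, 2 * (ξ + profile a t) * f t ^ 2 = P 0 := by
    have hd : ∀ t ∈ Set.Ioi (0 : ℝ),
        HasDerivAt (fun t => -P t) (2 * (ξ + profile a t) * f t ^ 2) t := by
      intro t ht
      have hq : HasDerivAt (potential a ξ) (2 * (ξ + profile a t)) t := by
        have h1 : HasDerivAt (fun s => (ξ + s) ^ 2) (2 * (ξ + t)) t :=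
          (((hasDerivAt_id t).const_add ξ).fun_pow 2).congr_deriv (by simp)
        have h2 : profile a t = t := if_neg (not_lt.2 (le_of_lt ht))
        rw [h2]
        refine h1.congr_of_eventuallyEq ?_
        filter_upwards [Ioi_mem_nhds ht] with s hs
        exact if_neg (not_lt.2 (le_of_lt hs))
      exact (hPd t _ hq).fun_neg.congr_deriv (neg_neg _)
    have := integral_Ioi_of_hasDerivAt_of_tendsto hPc.neg.continuousWithinAt hd
      hint.integrableOn (hPlim.mono_left atTop_le_cocompact).neg
    rw [this, Pi.neg_apply]
    ring
  have hleft : ∫ t in Set.Iic 0, 2 * (ξ + profile a t) * f t ^ 2 = -(1 / a) * P 0 := by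
    have hd : ∀ t ∈ Set.Iio (0 : ℝ),
        HasDerivAt (fun t => -(1 / a) * P t) (2 * (ξ + profile a t) * f t ^ 2) t := by
      intro t ht
      have hq : HasDerivAt (potential a ξ) (2 * a * (ξ + profile a t)) t := by
        have h1 : HasDerivAt (fun s => (ξ + a * s) ^ 2) (2 * a * (ξ + a * t)) t :=
          ((((hasDerivAt_id t).const_mul a).const_add ξ).fun_pow 2).congr_deriv
            (by simp only [id]; push_cast; ring)
        have h2 : profile a t = a * t := if_pos ht
        rw [h2]
        refine h1.congr_of_eventuallyEq ?_
        filter_upwards [Iio_mem_nhds ht] with s hs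
        exact if_pos hs
      refine ((hPd t _ hq).const_mul (-(1 / a))).congr_deriv ?_
      have := ha.2.ne
      field_simp
    have := integral_Iic_of_hasDerivAt_of_tendsto (continuous_const.mul hPc).continuousWithinAt hd
      hint.integrableOn ((hPlim.mono_left atBot_le_cocompact).const_mul _)
    rw [this, Pi.mul_apply]
    ring
  rw [← setIntegral_univ, ← Set.Iic_union_Ioi (a := (0 : ℝ)),
    setIntegral_union (Set.Iic_disjoint_Ioi le_rfl) measurableSet_Ioi hint.integrableOn
      hint.integrableOn, hleft, hright, hP0]
  ring

/-- `f(t)²` is the integral of `2 f g ≤ f² + g²` over `(-∞, t]`, and the kinetic part is at most the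
energy `L`. The bound involves only `L`, as needed for uniformity in `ξ`. -/
theorem sq_le (ha : a ∈ Set.Ico (-1 : ℝ) 0) (h : IsGround a ξ L f g) (t : ℝ) :
    f t ^ 2 ≤ 1 + L := by
  obtain ⟨B, hf, hg⟩ := h.decay
  have hi := (integrable_mul_of_decay h.sol.continuous_fst h.sol.continuous_snd hf hg).const_mul 2
  have hlim : Tendsto (fun t => f t ^ 2) (cocompact ℝ) (𝓝 0) := by
    simpa only [sq] using tendsto_mul_cocompact_of_decay hf hf
  have h1 := integral_Iic_of_hasDerivAt_of_tendsto' (a := t) (f := fun t => f t ^ 2)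
    (f' := fun t => 2 * (f t * g t))
    (fun s _ => ((h.sol.fst s).fun_pow 2).congr_deriv (by push_cast; ring)) hi.integrableOn
    (hlim.mono_left atBot_le_cocompact)
  have hi1 := h.integrable_sq_snd.add (h.integrable_potential ha ξ)
  have h2 : ∫ s in Set.Iic t, 2 * (f s * g s) ≤
      ∫ s, (f s ^ 2 + (g s ^ 2 + potential a ξ s * f s ^ 2)) := by
    have hi2 := h.integrable_sq_fst.add hi1
    refine (setIntegral_mono hi.integrableOn hi2.integrableOn fun s => ?_).trans
      (setIntegral_le_integral hi2 (ae_of_all _ fun s => ?_))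
    · have := mul_nonneg (potential_nonneg a ξ s) (sq_nonneg (f s))
      simp only [Pi.add_apply]
      nlinarith [sq_nonneg (f s - g s)]
    · have := mul_nonneg (potential_nonneg a ξ s) (sq_nonneg (f s))
      simp only [Pi.add_apply, Pi.zero_apply]
      positivity
  rw [integral_add h.integrable_sq_fst (by exact hi1), h.norm, h.integral_energy ha] at h2
  linarith

end IsGround

/-! ### Weak derivatives on the line -/

section WeakDerivatives

theorem intervalIntegrable_of_locallyIntegrable {p : ℝ → ℝ} (hp : LocallyIntegrable p) (a b : ℝ) :
    IntervalIntegrable p volume a b :=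
  (hp.integrableOn_isCompact isCompact_uIcc).intervalIntegrable

theorem integrable_smul_of_tsupport_subset {E : Type*} [NormedAddCommGroup E] [NormedSpace ℝ E]
    {Ω : Set ℝ} {w : ℝ → E} (hw : LocallyIntegrableOn w Ω) {φ : ℝ → ℝ} (hφ : Continuous φ)
    (hc : HasCompactSupport φ) (hs : tsupport φ ⊆ Ω) : Integrable fun t => φ t • w t := by
  have h1 : IntegrableOn w (tsupport φ) := hw.integrableOn_compact_subset hs hc
  have h2 : IntegrableOn (fun t => φ t • w t) (tsupport φ) :=
    h1.continuousOn_smul hφ.continuousOn hc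
  refine (integrableOn_iff_integrable_of_support_subset fun t ht => ?_).1 h2
  exact subset_tsupport φ fun h0 => ht (by simp [h0])

/-- The du Bois-Reymond lemma: a function on an interval whose weak derivative vanishes is
constant. -/
theorem exists_ae_eq_const {E : Type*} [NormedAddCommGroup E] [NormedSpace ℝ E] [CompleteSpace E]
    {Ω : Set ℝ} (hΩ : IsOpen Ω) (hconn : Ω.OrdConnected) (hne : Ω.Nonempty) {w : ℝ → E}
    (hw : LocallyIntegrableOn w Ω)
    (h : ∀ φ : ℝ → ℝ, ContDiff ℝ ∞ φ → HasCompactSupport φ → tsupport φ ⊆ Ω →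
      ∫ t, deriv φ t • w t = 0) : ∃ c : E, ∀ᵐ t, t ∈ Ω → w t = c := by
  obtain ⟨x₀, hx₀⟩ := hne
  obtain ⟨r, hr, hball⟩ := Metric.isOpen_iff.1 hΩ x₀ hx₀
  let b : ContDiffBump x₀ := ⟨r / 4, r / 2, by linarith, by linarith⟩
  set χ : ℝ → ℝ := b.normed volume with hχ
  have hχs : tsupport χ ⊆ Ω := by
    rw [hχ, b.tsupport_normed_eq]
    exact (Metric.closedBall_subset_ball (by simp only [b]; linarith)).trans hball
  have hχd : ContDiff ℝ ∞ χ := b.contDiff_normed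
  have hχc : HasCompactSupport χ := b.hasCompactSupport_normed
  refine ⟨∫ t, χ t • w t, ?_⟩
  set c := ∫ t, χ t • w t with hc
  have hcl : LocallyIntegrableOn (fun t => w t - c) Ω :=
    hw.sub (locallyIntegrableOn_const c)
  refine (hΩ.ae_eq_zero_of_integral_contDiff_smul_eq_zero hcl fun φ hφ hφc hφs => ?_).mono
    fun t ht htΩ => sub_eq_zero.1 (ht htΩ)
  set m := ∫ t, φ t with hm
  -- Subtracting `m` times the normalized bump makes the integral zero, so that `ψ` is the
  -- derivative of a compactly supported function `Φ`.
  set ψ : ℝ → ℝ := fun t => φ t - m * χ t with hψ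
  have hψd : ContDiff ℝ ∞ ψ := hφ.sub (contDiff_const.mul hχd)
  have hiφ : Integrable φ := hφ.continuous.integrable_of_hasCompactSupport hφc
  have hiχ : Integrable χ := hχd.continuous.integrable_of_hasCompactSupport hχc
  have hψ0 : ∫ t, ψ t = 0 := by
    simp only [hψ]
    rw [integral_sub hiφ (hiχ.const_mul m), integral_const_mul, b.integral_normed, mul_one, hm,
      sub_self]
  set K := tsupport φ ∪ tsupport χ
  have hK : IsCompact K := hφc.isCompact.union hχc.isCompact
  have hKΩ : K ⊆ Ω := Set.union_subset hφs hχs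
  have hKne : K.Nonempty := by
    refine ⟨x₀, Or.inr ?_⟩
    rw [hχ, b.tsupport_normed_eq]
    exact Metric.mem_closedBall_self (by simp only [b]; linarith)
  have hψK : ∀ t, t ∉ K → ψ t = 0 := by
    intro t ht
    have h1 : φ t = 0 := image_eq_zero_of_notMem_tsupport fun h => ht (Or.inl h)
    have h2 : χ t = 0 := image_eq_zero_of_notMem_tsupport fun h => ht (Or.inr h)
    simp [hψ, h1, h2]
  set l := sInf K
  set u := sSup K
  -- Here order-connectedness enters: `Φ` need not vanish in gaps of `K`, so the whole hull of `K`
  -- must lie in `Ω`.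
  have hlu : Set.Icc l u ⊆ Ω := hconn.out (hKΩ (hK.sInf_mem hKne)) (hKΩ (hK.sSup_mem hKne))
  have hKlu : K ⊆ Set.Icc l u := fun t ht => ⟨csInf_le hK.bddBelow ht, le_csSup hK.bddAbove ht⟩
  set Φ : ℝ → ℝ := fun t => ∫ s in l..t, ψ s with hΦ
  have hΦd : ∀ t, HasDerivAt Φ (ψ t) t := fun t =>
    (hψd.continuous.integral_hasStrictDerivAt l t).hasDerivAt
  have hderiv : deriv Φ = ψ := funext fun t => (hΦd t).deriv
  have hΦsmooth : ContDiff ℝ ∞ Φ :=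
    contDiff_infty_iff_deriv.2 ⟨fun t => (hΦd t).differentiableAt, by rwa [hderiv]⟩
  have hΦ0 : ∀ t, t ∉ Set.Icc l u → Φ t = 0 := by
    intro t ht
    rcases lt_or_ge t l with htl | htl
    · simp only [hΦ]
      rw [intervalIntegral.integral_symm, intervalIntegral.integral_of_le htl.le,
        setIntegral_congr_ae (g := fun _ => 0) measurableSet_Ioc]
      · simp
      · have : ∀ᵐ s : ℝ, s ≠ l := by simp [ae_iff]
        filter_upwards [this] with s hs hst
        exact hψK s fun hsK => hs (le_antisymm hst.2 (hKlu hsK).1)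
    · have htu : u < t := by
        by_contra! hle
        exact ht ⟨htl, hle⟩
      simp only [hΦ]
      rw [intervalIntegral.integral_of_le htl, ← integral_Icc_eq_integral_Ioc,
        setIntegral_eq_integral_of_forall_compl_eq_zero, hψ0]
      intro s hs
      exact hψK s fun hsK => hs ⟨(hKlu hsK).1, (hKlu hsK).2.trans htu.le⟩
  have hΦs : tsupport Φ ⊆ Set.Icc l u := closure_minimal
    (fun t ht => by by_contra hcon; exact ht (hΦ0 t hcon)) isClosed_Icc
  have hΦc : HasCompactSupport Φ :=
    isCompact_Icc.of_isClosed_subset (isClosed_tsupport Φ) hΦs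
  have key := h Φ hΦsmooth hΦc (hΦs.trans hlu)
  rw [hderiv] at key
  have i1 := integrable_smul_of_tsupport_subset hw hφ.continuous hφc hφs
  have i2 := integrable_smul_of_tsupport_subset hw hχd.continuous hχc hχs
  have e1 : ∫ t, ψ t • w t = (∫ t, φ t • w t) - m • c := by
    simp only [hψ, sub_smul, mul_smul]
    rw [integral_sub i1 (by exact i2.smul m), integral_smul]
  have e2 : ∫ t, φ t • (w t - c) = (∫ t, φ t • w t) - m • c := by
    simp only [smul_sub]
    rw [integral_sub i1 (hiφ.smul_const c), integral_smul_const]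
  rw [e2, ← e1, key]

theorem HasWeakDerivOn.mono {Ω Ω' : Set ℝ} {u v : ℝ → ℂ} (h : HasWeakDerivOn Ω u v)
    (hs : Ω' ⊆ Ω) : HasWeakDerivOn Ω' u v :=
  ⟨h.1.mono_set hs, h.2.mono_set hs, fun φ h1 h2 h3 => h.3 φ h1 h2 (h3.trans hs)⟩

theorem HasWeakDerivOn.ae_eq {u v v' : ℝ → ℂ} (h : HasWeakDerivOn Set.univ u v)
    (h' : HasWeakDerivOn Set.univ u v') : v =ᵐ[volume] v' := by
  refine ae_eq_of_integral_contDiff_smul_eq (locallyIntegrableOn_univ.1 h.2)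
    (locallyIntegrableOn_univ.1 h'.2) fun φ h1 h2 => ?_
  have e1 := h.3 φ h1 h2 (Set.subset_univ _)
  have e2 := h'.3 φ h1 h2 (Set.subset_univ _)
  exact neg_injective (e1.symm.trans e2)

theorem HasWeakDerivOn.weakDeriv_spec {u v : ℝ → ℂ} (h : HasWeakDerivOn Set.univ u v) :
    HasWeakDerivOn Set.univ u (weakDeriv u) := by
  have hex : ∃ v, HasWeakDerivOn Set.univ u v := ⟨v, h⟩
  unfold weakDeriv
  rw [dif_pos hex]
  exact hex.choose_spec

theorem HasWeakDerivOn.exists_sub_ae_eq_const {Ω : Set ℝ} (hΩ : IsOpen Ω)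
    (hconn : Ω.OrdConnected) (hne : Ω.Nonempty) {u u' v v' : ℝ → ℂ} (h : HasWeakDerivOn Ω u v)
    (h' : HasWeakDerivOn Ω u' v') (hv : v =ᵐ[volume] v') :
    ∃ c : ℂ, ∀ᵐ t, t ∈ Ω → u t - u' t = c := by
  refine exists_ae_eq_const hΩ hconn hne (h.1.sub h'.1) fun φ h1 h2 h3 => ?_
  have hd : Continuous (deriv φ) := h1.continuous_deriv (by simp)
  have hdc : HasCompactSupport (deriv φ) := h2.deriv
  have hds : tsupport (deriv φ) ⊆ Ω :=
    (closure_minimal (support_deriv_subset (f := φ)) (isClosed_tsupport φ)).trans h3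
  simp only [smul_sub]
  rw [integral_sub (integrable_smul_of_tsupport_subset h.1 hd hdc hds)
    (integrable_smul_of_tsupport_subset h'.1 hd hdc hds), h.3 φ h1 h2 h3, h'.3 φ h1 h2 h3,
    integral_congr_ae (g := fun t => φ t • v' t) (hv.mono fun t ht => by simp only [ht]), sub_self]

theorem hasWeakDerivOn_of_hasDerivAt {F G : ℝ → ℂ} (hG : Continuous G)
    (h : ∀ t, HasDerivAt F (G t) t) : HasWeakDerivOn Set.univ F G := by
  have hF : Continuous F := continuous_iff_continuousAt.2 fun t => (h t).continuousAt
  refine ⟨hF.locallyIntegrable.locallyIntegrableOn _, hG.locallyIntegrable.locallyIntegrableOn _,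
    fun φ h1 h2 _ => ?_⟩
  have hd : Continuous (deriv φ) := h1.continuous_deriv (by simp)
  have i1 := hG.locallyIntegrable.integrable_smul_left_of_hasCompactSupport (μ := volume)
    h1.continuous h2
  have i2 := hF.locallyIntegrable.integrable_smul_left_of_hasCompactSupport (μ := volume) hd h2.deriv
  have i3 := hF.locallyIntegrable.integrable_smul_left_of_hasCompactSupport (μ := volume)
    h1.continuous h2
  have := integral_bilinear_hasDerivAt_right_eq_neg_left_of_integrable
    (L := ContinuousLinearMap.lsmul ℝ ℝ) (u := φ) (v := F) (u' := deriv φ) (v' := G)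
    (fun t _ => (h1.differentiable (by simp) t).hasDerivAt) (fun t _ => h t) i1 i2 i3
  simp only [ContinuousLinearMap.lsmul_apply] at this
  rw [this, neg_neg]

/-- Since `p` is only locally integrable, its primitive is absolutely continuous with derivative `p`
almost everywhere; integration by parts holds in that class. -/
theorem integral_deriv_mul_primitive {p : ℝ → ℝ} (hp : LocallyIntegrable p) {φ : ℝ → ℝ}
    (h1 : ContDiff ℝ ∞ φ) (h2 : HasCompactSupport φ) :
    ∫ t, deriv φ t * (∫ s in (0 : ℝ)..t, p s) = - ∫ t, φ t * p t := by
  obtain ⟨R, hR, hsub⟩ : ∃ R : ℝ, 0 < R ∧ tsupport φ ⊆ Set.Ioo (-R) R := by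
    obtain ⟨R, hR⟩ := h2.isCompact.isBounded.subset_ball 0
    refine ⟨max R 1, by positivity, fun t ht => ?_⟩
    have := hR ht
    rw [mem_ball_zero_iff, Real.norm_eq_abs] at this
    exact abs_lt.1 (this.trans_le (le_max_left _ _))
  set F : ℝ → ℝ := fun t => ∫ s in (0 : ℝ)..t, p s with hF
  have hii : IntervalIntegrable p volume (-R) R := intervalIntegrable_of_locallyIntegrable hp _ _
  have hAF : AbsolutelyContinuousOnInterval F (-R) R :=
    hii.absolutelyContinuousOnInterval_intervalIntegral (c := 0)
      (by rw [Set.uIcc_of_le (by linarith)]; exact ⟨by linarith, hR.le⟩)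
  have hAφ : AbsolutelyContinuousOnInterval φ (-R) R :=
    (h1.of_le (by simp)).contDiffOn.absolutelyContinuousOnInterval
  have key := hAφ.integral_deriv_mul_eq_sub hAF
  have z : ∀ t, t ∉ Set.Ioo (-R) R → φ t = 0 := fun t ht =>
    image_eq_zero_of_notMem_tsupport fun h => ht (hsub h)
  have zd : ∀ t, t ∉ Set.Ioo (-R) R → deriv φ t = 0 := fun t ht => by
    by_contra hne
    exact ht (hsub (support_deriv_subset hne))
  rw [z R (by simp), z (-R) (by simp), zero_mul, zero_mul, sub_zero] at key
  have hFc : Continuous F := intervalIntegral.continuous_primitive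
    (intervalIntegrable_of_locallyIntegrable hp) 0
  have hd : Continuous (deriv φ) := h1.continuous_deriv (by simp)
  have key2 : ∫ t in (-R)..R, (deriv φ t * F t + φ t * p t) = 0 := by
    rw [← key]
    refine intervalIntegral.integral_congr_ae ?_
    filter_upwards [LocallyIntegrable.ae_hasDerivAt_integral hp] with t ht _
    rw [(ht 0).deriv]
  have i1 : Integrable fun t => φ t * p t :=
    hp.integrable_smul_left_of_hasCompactSupport h1.continuous h2
  have i2 : Integrable fun t => deriv φ t * F t :=
    hFc.locallyIntegrable.integrable_smul_left_of_hasCompactSupport hd h2.deriv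
  rw [intervalIntegral.integral_of_le (by linarith),
    setIntegral_eq_integral_of_forall_compl_eq_zero, integral_add i2 i1] at key2
  · linarith
  · intro t ht
    have : t ∉ Set.Ioo (-R) R := fun h => ht (Set.Ioo_subset_Ioc_self h)
    rw [z t this, zd t this, zero_mul, zero_mul, add_zero]

/-- A weakly differentiable function is almost everywhere a primitive of its derivative, in real
components. -/
theorem HasWeakDerivOn.exists_ae_eq_primitive {u v : ℝ → ℂ} (h : HasWeakDerivOn Set.univ u v)
    (T : ℂ →L[ℝ] ℝ) :
    ∃ c : ℝ, ∀ᵐ t, T (u t) = c + ∫ s in (0 : ℝ)..t, T (v s) := by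
  have hu : LocallyIntegrable u := locallyIntegrableOn_univ.1 h.1
  have hv : LocallyIntegrable v := locallyIntegrableOn_univ.1 h.2
  have hTu : LocallyIntegrable fun t => T (u t) := fun t => by
    obtain ⟨s, hs, hi⟩ := hu t
    exact ⟨s, hs, T.integrable_comp hi⟩
  have hTv : LocallyIntegrable fun t => T (v t) := fun t => by
    obtain ⟨s, hs, hi⟩ := hv t
    exact ⟨s, hs, T.integrable_comp hi⟩
  have hFc : Continuous fun t => ∫ s in (0 : ℝ)..t, T (v s) := intervalIntegral.continuous_primitive
    (intervalIntegrable_of_locallyIntegrable hTv) 0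
  obtain ⟨c, hc⟩ := exists_ae_eq_const isOpen_univ Set.ordConnected_univ Set.univ_nonempty
    ((hTu.sub hFc.locallyIntegrable).locallyIntegrableOn _) (fun φ h1 h2 h3 => by
      have hd : Continuous (deriv φ) := h1.continuous_deriv (by simp)
      have j1 := hTu.integrable_smul_left_of_hasCompactSupport hd h2.deriv
      have j2 := hFc.locallyIntegrable.integrable_smul_left_of_hasCompactSupport (μ := volume)
        hd h2.deriv
      have e := congrArg T (h.3 φ h1 h2 h3)
      rw [map_neg,
        ← T.integral_comp_comm (hu.integrable_smul_left_of_hasCompactSupport hd h2.deriv),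
        ← T.integral_comp_comm (hv.integrable_smul_left_of_hasCompactSupport h1.continuous h2)] at e
      simp only [map_smul, smul_eq_mul] at e
      simp only [Pi.sub_apply, smul_sub]
      rw [integral_sub j1 j2]
      simp only [smul_eq_mul]
      rw [e, integral_deriv_mul_primitive hTv h1 h2, sub_self])
  refine ⟨c, hc.mono fun t ht => ?_⟩
  have := ht (Set.mem_univ t)
  simp only [Pi.sub_apply] at this
  linarith

end WeakDerivatives

/-! ### Picone's identity and the lower bound for the form -/

theorem IsSol.hasDerivAt_div {Q f g : ℝ → ℝ} (h : IsSol Q f g) (hpos : ∀ t, 0 < f t) (t : ℝ) :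
    HasDerivAt (fun t => g t / f t) (Q t - (g t / f t) ^ 2) t := by
  refine ((h.snd t).fun_div (h.fst t) (hpos t).ne').congr_deriv ?_
  have := (hpos t).ne'
  field_simp

/-- Picone's identity on a symmetric interval. -/
theorem IsSol.integral_picone {Q f g : ℝ → ℝ} (h : IsSol Q f g) (hQ : Continuous Q)
    (hpos : ∀ t, 0 < f t) {p F : ℝ → ℝ} (hp : LocallyIntegrable p) {c : ℝ}
    (hF : ∀ t, F t = c + ∫ s in (0 : ℝ)..t, p s) {R : ℝ} (hR : 0 ≤ R) :
    ∫ t in (-R)..R, (p t ^ 2 + Q t * F t ^ 2 - (p t - g t / f t * F t) ^ 2) =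
      g R / f R * F R ^ 2 - g (-R) / f (-R) * F (-R) ^ 2 := by
  have hh := h.hasDerivAt_div hpos
  have hhc : Continuous fun t => g t / f t :=
    h.continuous_snd.div h.continuous_fst fun t => (hpos t).ne'
  have hA : AbsolutelyContinuousOnInterval (fun t => g t / f t) (-R) R := by
    refine (contDiff_one_iff_deriv.2 ⟨fun t => (hh t).differentiableAt, ?_⟩).contDiffOn
      |>.absolutelyContinuousOnInterval
    rw [show deriv (fun t => g t / f t) = fun t => Q t - (g t / f t) ^ 2 from
      funext fun t => (hh t).deriv]
    exact hQ.sub (hhc.pow 2)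
  have hAF : AbsolutelyContinuousOnInterval F (-R) R := by
    have h1 : AbsolutelyContinuousOnInterval (fun t => ∫ s in (0 : ℝ)..t, p s) (-R) R :=
      (intervalIntegrable_of_locallyIntegrable hp _ _
        ).absolutelyContinuousOnInterval_intervalIntegral
        (by rw [Set.uIcc_of_le (by linarith)]; exact ⟨by linarith, hR⟩)
    have h2 : AbsolutelyContinuousOnInterval (fun _ => c) (-R) R :=
      contDiff_const.contDiffOn.absolutelyContinuousOnInterval
    have h3 : F = fun t => c + ∫ s in (0 : ℝ)..t, p s := funext hF
    rw [h3]
    exact h2.fun_add h1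
  -- The Riccati equation `(g/f)' = Q - (g/f)²` turns the derivative of `(g/f) F²` into `p² + Q F² -
  -- (p - (g/f) F)²`.
  have key := (hA.fun_mul (hAF.fun_mul hAF)).integral_deriv_eq_sub
  rw [show g R / f R * F R ^ 2 - g (-R) / f (-R) * F (-R) ^ 2 =
    g R / f R * (F R * F R) - g (-R) / f (-R) * (F (-R) * F (-R)) by ring, ← key]
  refine intervalIntegral.integral_congr_ae ?_
  filter_upwards [LocallyIntegrable.ae_hasDerivAt_integral hp] with t ht _
  have hFd : HasDerivAt F (p t) t := by
    have h3 : F = fun t => c + ∫ s in (0 : ℝ)..t, p s := funext hF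
    rw [h3]
    exact (ht 0).const_add c
  rw [((hh t).fun_mul (hFd.fun_mul hFd)).deriv]
  ring

/-- These are the signs needed for a lower bound on the boundary terms of Picone's identity over
`[-t, t]`; the growth is only linear in `t`. -/
theorem IsGround.le_div {a : ℝ} (ha : a ∈ Set.Ico (-1 : ℝ) 0) {ξ L : ℝ} {f g : ℝ → ℝ}
    (h : IsGround a ξ L f g) {t : ℝ} (ht : 0 ≤ t) :
    -(|ξ| + 1 + t) ≤ g t / f t ∧ g (-t) / f (-t) ≤ |ξ| + 1 + t := by
  have hQ : ∀ s, potential a ξ s - L + 1 ≤ (|ξ| + 1 + |s|) ^ 2 := by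
    intro s
    have := potential_le ha ξ s
    nlinarith [h.nonneg, abs_nonneg ξ, abs_nonneg s]
  have hC : 0 ≤ |ξ| + 1 := by positivity
  constructor
  · rw [le_div_iff₀ (h.pos t)]
    exact h.sol.neg_mul_le_snd hC h.pos
      (fun s hs => by simpa [abs_of_nonneg hs] using hQ s) ht
  · rw [div_le_iff₀ (h.pos (-t))]
    have := h.sol.comp_neg.neg_mul_le_snd hC (fun s => h.pos _)
      (fun s hs => by simpa [abs_of_nonneg hs] using hQ (-s)) ht
    linarith

theorem integrable_potential_sub_mul {a : ℝ} (ha : a ∈ Set.Ico (-1 : ℝ) 0) {ξ L : ℝ} (hL : 0 ≤ L)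
    {F : ℝ → ℝ} (hFc : Continuous F) (hF2 : Integrable fun t => (1 + |t|) ^ 2 * F t ^ 2) :
    Integrable fun t => (potential a ξ t - L) * F t ^ 2 := by
  have hQc : Continuous fun t => potential a ξ t - L :=
    (continuous_potential a ξ).sub continuous_const
  refine (hF2.const_mul ((|ξ| + 1) ^ 2 + L)).mono' (hQc.mul (hFc.pow 2)).aestronglyMeasurable
    (ae_of_all _ fun t => ?_)
  rw [Real.norm_eq_abs, abs_mul, abs_of_nonneg (sq_nonneg (F t)), ← mul_assoc]
  refine mul_le_mul_of_nonneg_right ?_ (sq_nonneg _)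
  refine (abs_sub _ _).trans ?_
  rw [abs_of_nonneg hL, add_mul]
  have := abs_potential_le ha ξ t
  have h1 : 1 ≤ (1 + |t|) ^ 2 := by nlinarith [abs_nonneg t]
  nlinarith [hL]

/-- The remainder term in Picone's identity bounds the excess energy from below. -/
theorem IsGround.picone_le {a : ℝ} (ha : a ∈ Set.Ico (-1 : ℝ) 0) {ξ L : ℝ} {f g : ℝ → ℝ}
    (h : IsGround a ξ L f g) {p F : ℝ → ℝ} (hp : LocallyIntegrable p) {c : ℝ}
    (hF : ∀ t, F t = c + ∫ s in (0 : ℝ)..t, p s) (hp2 : Integrable fun t => p t ^ 2)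
    (hF2 : Integrable fun t => (1 + |t|) ^ 2 * F t ^ 2) {R : ℝ} (hR : 0 ≤ R) :
    ∫ t in (-R)..R, (p t - g t / f t * F t) ^ 2 ≤
      ∫ t, (p t ^ 2 + (potential a ξ t - L) * F t ^ 2) := by
  have hQc : Continuous fun t => potential a ξ t - L := (continuous_potential a ξ).sub continuous_const
  have hFc : Continuous F := by
    rw [show F = fun t => c + ∫ s in (0 : ℝ)..t, p s from funext hF]
    exact continuous_const.add
      (intervalIntegral.continuous_primitive (intervalIntegrable_of_locallyIntegrable hp) 0)
  have hhc : Continuous fun t => g t / f t :=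
    h.sol.continuous_snd.div h.sol.continuous_fst fun t => (h.pos t).ne'
  set C := |ξ| + 1 with hC
  have hC1 : 1 ≤ C := by simp [hC]
  have hQF := integrable_potential_sub_mul ha h.nonneg hFc hF2 (ξ := ξ)
  have hint : Integrable fun t => p t ^ 2 + (potential a ξ t - L) * F t ^ 2 := hp2.add hQF
  have hrem : ∀ R, IntervalIntegrable (fun t => (p t - g t / f t * F t) ^ 2) volume (-R) R := by
    intro R
    have h1 : IntervalIntegrable (fun t => p t * (2 * (g t / f t * F t))) volume (-R) R :=
      (intervalIntegrable_of_locallyIntegrable hp _ _).mul_continuousOn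
        (continuous_const.mul (hhc.mul hFc)).continuousOn
    have h2 := (hp2.intervalIntegrable (a := -R) (b := R)).sub h1
    have h3 := h2.add (((hhc.mul hFc).pow 2).intervalIntegrable (μ := volume) (-R) R)
    refine h3.congr fun t _ => ?_
    simp only [Pi.pow_apply, Pi.mul_apply]
    ring
  set K := ∫ t in (-R)..R, (p t - g t / f t * F t) ^ 2 with hK
  set I := ∫ t, (p t ^ 2 + (potential a ξ t - L) * F t ^ 2) with hI
  have hbound : ∀ S, R ≤ S → K - (C + S) * (F S ^ 2 + F (-S) ^ 2) ≤
      ∫ t in (-S)..S, (p t ^ 2 + (potential a ξ t - L) * F t ^ 2) := by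
    intro S hS
    have hS0 := hR.trans hS
    have h1 := h.sol.integral_picone hQc h.pos hp hF hS0
    rw [intervalIntegral.integral_sub (hint.intervalIntegrable) (hrem S)] at h1
    have h2 : K ≤ ∫ t in (-S)..S, (p t - g t / f t * F t) ^ 2 :=
      intervalIntegral.integral_mono_interval (by linarith) (by linarith) hS
        (ae_of_all _ fun t => sq_nonneg _) (hrem S)
    obtain ⟨h3, h4⟩ := h.le_div ha hS0
    have h5 := mul_le_mul_of_nonneg_right h3 (sq_nonneg (F S))
    have h6 := mul_le_mul_of_nonneg_right h4 (sq_nonneg (F (-S)))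
    linarith
  -- Otherwise `hbound` forces `(C + S)(F(S)² + F(-S)²) ≥ (K - I)/2 > 0` for all large `S`. The left
  -- side is dominated by an integrable function, whereas a positive constant is not integrable on a
  -- half-line.
  by_contra! hlt
  have hlim : Tendsto (fun S : ℝ => ∫ t in (-S)..S,
      (p t ^ 2 + (potential a ξ t - L) * F t ^ 2)) atTop (𝓝 I) :=
    intervalIntegral_tendsto_integral hint tendsto_neg_atTop_atBot tendsto_id
  obtain ⟨S₀, hS₀⟩ := ((hlim.eventually_lt_const (show I < (I + K) / 2 by linarith)).and
    (eventually_ge_atTop R)).exists_forall_of_atTop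
  have hi1 : Integrable fun t => C * ((1 + |t|) ^ 2 * F t ^ 2) := hF2.const_mul C
  have hi2 : Integrable fun t => C * ((1 + |t|) ^ 2 * F t ^ 2) +
      C * ((1 + |-t|) ^ 2 * F (-t) ^ 2) := hi1.add hi1.comp_neg
  have hconst : IntegrableOn (fun _ : ℝ => (K - I) / 2) (Set.Ioi S₀) := by
    refine hi2.integrableOn.mono' aestronglyMeasurable_const
      ((ae_restrict_iff' measurableSet_Ioi).2 (ae_of_all _ fun S hS => ?_))
    obtain ⟨h1, h2⟩ := hS₀ S (le_of_lt hS)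
    have h3 := hbound S h2
    have hS0 := hR.trans h2
    rw [Real.norm_eq_abs, abs_of_pos (by linarith), abs_neg, abs_of_nonneg hS0]
    have h4 : C + S ≤ C * (1 + S) ^ 2 := by
      nlinarith [mul_nonneg (sub_nonneg.2 hC1) hS0, mul_nonneg (by linarith : 0 ≤ C) (sq_nonneg S)]
    have h5 := mul_le_mul_of_nonneg_right h4 (add_nonneg (sq_nonneg (F S)) (sq_nonneg (F (-S))))
    linarith
  rw [integrableOn_const_iff] at hconst
  rcases hconst with h0 | h0
  · rw [enorm_eq_zero] at h0
    linarith
  · simp at h0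

/-! ### The variational characterization of the ground energy -/

theorem MemB1.weakDeriv_spec {u : ℝ → ℂ} (hu : MemB1 u) :
    HasWeakDerivOn Set.univ u (weakDeriv u) ∧ MemLp (weakDeriv u) 2 := by
  obtain ⟨v, hv, hv2⟩ := hu.exists_weakDeriv
  exact ⟨hv.weakDeriv_spec, hv2.ae_eq (hv.ae_eq hv.weakDeriv_spec)⟩

theorem MemB1.integrable_weight {u : ℝ → ℂ} (hu : MemB1 u) :
    Integrable fun t => (1 + |t|) ^ 2 * ‖u t‖ ^ 2 := by
  have h1 := hu.memLp.integrable_norm_pow (p := 2) (by norm_num)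
  have h2 := hu.memLp_mul.integrable_norm_pow (p := 2) (by norm_num)
  refine ((h1.const_mul 2).add (h2.const_mul 2)).mono'
    ((by fun_prop : Continuous fun t : ℝ => (1 + |t|) ^ 2).aestronglyMeasurable.mul
      h1.aestronglyMeasurable) (ae_of_all _ fun t => ?_)
  simp only [norm_smul, Pi.add_apply, Real.norm_eq_abs]
  rw [abs_of_nonneg (by positivity), mul_pow]
  nlinarith [sq_nonneg (1 - |t|), sq_nonneg ‖u t‖, mul_nonneg (sq_nonneg (1 - |t|)) (sq_nonneg ‖u t‖)]

theorem sq_norm_eq_re_add_im (z : ℂ) : ‖z‖ ^ 2 = z.re ^ 2 + z.im ^ 2 := by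
  rw [Complex.sq_norm, Complex.normSq_apply]; ring

/-- `T` stands for the real or the imaginary part. Picone's identity needs an absolutely continuous
real function, so `T ∘ u` is replaced by the primitive `F` that it equals almost everywhere. -/
theorem IsGround.component_nonneg {a : ℝ} (ha : a ∈ Set.Ico (-1 : ℝ) 0) {ξ L : ℝ} {f g : ℝ → ℝ}
    (h : IsGround a ξ L f g) {u : ℝ → ℂ} (hu : MemB1 u) {T : ℂ →L[ℝ] ℝ}
    (hT : ∀ z, T z ^ 2 ≤ ‖z‖ ^ 2) :
    (Integrable fun t => T (weakDeriv u t) ^ 2 + (potential a ξ t - L) * T (u t) ^ 2) ∧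
      0 ≤ ∫ t, (T (weakDeriv u t) ^ 2 + (potential a ξ t - L) * T (u t) ^ 2) := by
  obtain ⟨hv, hv2⟩ := hu.weakDeriv_spec
  have hloc : LocallyIntegrable fun t => T (weakDeriv u t) := fun t => by
    obtain ⟨s, hs, hi⟩ := locallyIntegrableOn_univ.1 hv.2 t
    exact ⟨s, hs, T.integrable_comp hi⟩
  obtain ⟨c, hc⟩ := hv.exists_ae_eq_primitive T
  set F : ℝ → ℝ := fun t => c + ∫ s in (0 : ℝ)..t, T (weakDeriv u s) with hF
  have hFc : Continuous F := continuous_const.add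
    (intervalIntegral.continuous_primitive (intervalIntegrable_of_locallyIntegrable hloc) 0)
  have hp2 : Integrable fun t => T (weakDeriv u t) ^ 2 := by
    refine (hv2.integrable_norm_pow (p := 2) (by norm_num)).mono'
      ((T.continuous.comp_aestronglyMeasurable hv2.1).pow 2) (ae_of_all _ fun t => ?_)
    rw [Real.norm_eq_abs, abs_of_nonneg (sq_nonneg _)]
    exact hT _
  have hF2 : Integrable fun t => (1 + |t|) ^ 2 * F t ^ 2 := by
    refine hu.integrable_weight.mono' ((by fun_prop : Continuous fun t : ℝ =>
      (1 + |t|) ^ 2).mul (hFc.pow 2)).aestronglyMeasurable (hc.mono fun t ht => ?_)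
    rw [Real.norm_eq_abs, abs_of_nonneg (by positivity), ← show T (u t) = F t from ht]
    exact mul_le_mul_of_nonneg_left (hT _) (by positivity)
  have heq : (fun t => T (weakDeriv u t) ^ 2 + (potential a ξ t - L) * T (u t) ^ 2) =ᵐ[volume]
      fun t => T (weakDeriv u t) ^ 2 + (potential a ξ t - L) * F t ^ 2 :=
    hc.mono fun t ht => by simp only [ht, hF]
  -- With `R = 0` the remainder integral is empty and only nonnegativity is kept.
  have hpic := h.picone_le ha hloc (fun t => rfl) hp2 hF2 le_rfl
  refine ⟨(hp2.add (integrable_potential_sub_mul ha h.nonneg hFc hF2)).congr heq.symm, ?_⟩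
  rw [integral_congr_ae heq]
  simpa using hpic

theorem IsGround.mul_integral_le_quadForm {a : ℝ} (ha : a ∈ Set.Ico (-1 : ℝ) 0) {ξ L : ℝ} {f g : ℝ → ℝ}
    (h : IsGround a ξ L f g) {u : ℝ → ℂ} (hu : MemB1 u) :
    L * ∫ t, ‖u t‖ ^ 2 ≤ quadForm a ξ u := by
  have h1 := hu.memLp.integrable_norm_pow (p := 2) (by norm_num)
  have h2 := hu.weakDeriv_spec.2.integrable_norm_pow (p := 2) (by norm_num)
  obtain ⟨i1, n1⟩ := h.component_nonneg ha hu (T := Complex.reCLM)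
    (fun z => by rw [sq_norm_eq_re_add_im]; simp [sq_nonneg])
  obtain ⟨i2, n2⟩ := h.component_nonneg ha hu (T := Complex.imCLM)
    (fun z => by rw [sq_norm_eq_re_add_im]; simp [sq_nonneg])
  have h3 := add_nonneg n1 n2
  rw [← integral_add i1 i2] at h3
  have h4 : ∀ t, Complex.reCLM (weakDeriv u t) ^ 2 + (potential a ξ t - L) * Complex.reCLM (u t) ^ 2
      + (Complex.imCLM (weakDeriv u t) ^ 2 + (potential a ξ t - L) * Complex.imCLM (u t) ^ 2) =
      (‖weakDeriv u t‖ ^ 2 + potential a ξ t * ‖u t‖ ^ 2) - L * ‖u t‖ ^ 2 := by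
    intro t
    rw [sq_norm_eq_re_add_im, sq_norm_eq_re_add_im]
    simp only [Complex.reCLM_apply, Complex.imCLM_apply]
    ring
  have i3 : Integrable fun t => ‖weakDeriv u t‖ ^ 2 + potential a ξ t * ‖u t‖ ^ 2 := by
    refine ((i1.add i2).add (h1.const_mul L)).congr (ae_of_all _ fun t => ?_)
    have := h4 t
    simp only [Pi.add_apply] at this ⊢
    linarith
  simp only [h4] at h3
  rw [integral_sub i3 (h1.const_mul L), integral_const_mul] at h3
  unfold quadForm
  linarith

theorem hasWeakDerivOn_ofReal {f g : ℝ → ℝ} (hg : Continuous g) (h : ∀ t, HasDerivAt f (g t) t) :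
    HasWeakDerivOn Set.univ (fun t => (f t : ℂ)) (fun t => (g t : ℂ)) :=
  hasWeakDerivOn_of_hasDerivAt (Complex.continuous_ofReal.comp hg) fun t => (h t).ofReal_comp

theorem memLp_two_ofReal {f : ℝ → ℝ} (hf : Continuous f) (h : Integrable fun t => f t ^ 2) :
    MemLp (fun t => (f t : ℂ)) 2 := by
  refine (memLp_two_iff_integrable_sq_norm
    (Complex.continuous_ofReal.comp hf).aestronglyMeasurable).2 (h.congr (ae_of_all _ fun t => ?_))
  simp

namespace IsGround

variable {a ξ L : ℝ} {f g : ℝ → ℝ}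

theorem hasWeakDerivOn (h : IsGround a ξ L f g) :
    HasWeakDerivOn Set.univ (fun t => (f t : ℂ)) (fun t => (g t : ℂ)) :=
  hasWeakDerivOn_ofReal h.sol.continuous_snd h.sol.fst

theorem integrable_sq_weight (h : IsGround a ξ L f g) :
    Integrable fun t => (1 + |t|) ^ 2 * f t ^ 2 :=
  h.integrable_weight (by fun_prop) (K := 1) fun t => by rw [abs_of_nonneg (by positivity), one_mul]

theorem memB1 (h : IsGround a ξ L f g) : MemB1 fun t => (f t : ℂ) := by
  refine ⟨memLp_two_ofReal h.sol.continuous_fst h.integrable_sq_fst, ?_,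
    _, h.hasWeakDerivOn, memLp_two_ofReal h.sol.continuous_snd h.integrable_sq_snd⟩
  have := memLp_two_ofReal (f := fun t => t * f t) (continuous_id.mul h.sol.continuous_fst)
    (by
      simp only [mul_pow]
      refine h.integrable_weight (w := fun t => t ^ 2) (by fun_prop) (K := 1) fun t => ?_
      rw [abs_of_nonneg (sq_nonneg _), one_mul, ← sq_abs]
      gcongr
      linarith)
  simpa using this

theorem quadForm_eq (h : IsGround a ξ L f g) (η : ℝ) :
    quadForm a η (fun t => (f t : ℂ)) = ∫ t, (g t ^ 2 + potential a η t * f t ^ 2) := by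
  refine integral_congr_ae ((h.hasWeakDerivOn.weakDeriv_spec.ae_eq h.hasWeakDerivOn).mono
    fun t ht => ?_)
  simp [ht]

/-- The integrated equation shows that `f` attains the quotient `L`, and Picone's identity that
nothing in `B¹` goes below it. -/
theorem groundEnergy_eq (ha : a ∈ Set.Ico (-1 : ℝ) 0) (h : IsGround a ξ L f g) :
    groundEnergy a ξ = L := by
  refine IsLeast.csInf_eq ⟨⟨fun t => (f t : ℂ), h.memB1, fun h0 => ?_, ?_⟩, ?_⟩
  · obtain ⟨t, ht⟩ := h0.exists
    exact (h.pos t).ne' (by simpa using ht)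
  · rw [h.quadForm_eq, h.integral_energy ha]
    simp [h.norm]
  · rintro r ⟨u, hu, hu0, rfl⟩
    have hi := hu.memLp.integrable_norm_pow (p := 2) (by norm_num)
    have hpos : 0 < ∫ t, ‖u t‖ ^ 2 := by
      refine (integral_nonneg fun t => by positivity).lt_of_ne' fun h0 => hu0 ?_
      rw [integral_eq_zero_iff_of_nonneg (fun t => by positivity) hi] at h0
      exact h0.mono fun t ht => by simpa using ht
    rw [le_div_iff₀ hpos]
    exact h.mul_integral_le_quadForm ha hu

theorem isPositiveGroundState (ha : a ∈ Set.Ico (-1 : ℝ) 0) (h : IsGround a ξ L f g) :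
    IsPositiveGroundState a ξ f := by
  have hQ : Continuous fun t => (potential a ξ t - L) * f t :=
    ((continuous_potential a ξ).sub continuous_const).mul h.sol.continuous_fst
  have hg : Continuous fun t => (g t : ℂ) := Complex.continuous_ofReal.comp h.sol.continuous_snd
  refine ⟨h.sol.continuous_fst, h.pos, h.norm, h.memB1, ?_, fun t => (g t : ℂ),
    fun t => (((potential a ξ t - L) * f t : ℝ) : ℂ), (g 0 : ℂ), h.hasWeakDerivOn,
    (hasWeakDerivOn_ofReal hQ h.sol.snd).mono (Set.subset_univ _), ?_,
    (hg.tendsto 0).mono_left nhdsWithin_le_nhds, (hg.tendsto 0).mono_left nhdsWithin_le_nhds⟩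
  · exact h.memB1.memLp.const_smul (groundEnergy a ξ)
  · refine ae_of_all _ fun t => ?_
    rw [h.groundEnergy_eq ha]
    simp only [Complex.real_smul]
    push_cast
    ring

end IsGround

/-! ### Regularity and uniqueness of positive ground states -/

theorem eq_of_tendsto_of_ae_eq {v G : ℝ → ℂ} (hG : Continuous G) {S : Set ℝ}
    (hS : ∀ ε > 0, volume (S ∩ Metric.ball 0 ε) ≠ 0) {L c : ℂ} (hv : Tendsto v (𝓝[S] 0) (𝓝 L))
    (hc : ∀ᵐ t, t ∈ S → v t - G t = c) : L = c + G 0 := by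
  have hlim : Tendsto (fun t => v t - G t) (𝓝[S] 0) (𝓝 (L - G 0)) :=
    hv.sub ((hG.tendsto 0).mono_left nhdsWithin_le_nhds)
  suffices L - G 0 = c by rw [← this]; ring
  refine eq_of_forall_dist_le fun ε hε => ?_
  obtain ⟨δ, hδ, hball⟩ := Metric.mem_nhdsWithin_iff.1 (hlim (Metric.ball_mem_nhds _ hε))
  -- The relation `v - G = c` holds only almost everywhere, but `S` has positive measure near `0`,
  -- so some nearby point satisfies it.
  have hne : ∃ t, t ∈ S ∩ Metric.ball 0 δ ∧ (t ∈ S → v t - G t = c) := by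
    by_contra! hcon
    refine hS δ hδ (measure_mono_null (fun t ht => ?_) hc)
    obtain ⟨h1, h2⟩ := hcon t ht
    exact fun h => h2 (h h1)
  obtain ⟨t, ⟨htS, htb⟩, ht⟩ := hne
  have := hball ⟨htb, htS⟩
  rw [Set.mem_preimage, ht htS, Metric.mem_ball, dist_comm] at this
  exact this.le

/-- A positive ground state is a classical solution. -/
theorem IsPositiveGroundState.exists_isSol {a ξ : ℝ} {f : ℝ → ℝ}
    (h : IsPositiveGroundState a ξ f) :
    ∃ g : ℝ → ℝ, IsSol (fun t => potential a ξ t - groundEnergy a ξ) f g ∧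
      MemLp f 2 ∧ MemLp g 2 := by
  obtain ⟨hB, -, v, z, L, hv, hz, hw, hr, hl⟩ := h.eigen
  set q : ℝ → ℝ := fun t => (potential a ξ t - groundEnergy a ξ) * f t with hq
  have hqc : Continuous q := ((continuous_potential a ξ).sub continuous_const).mul h.continuous
  set G : ℝ → ℝ := fun t => ∫ s in (0 : ℝ)..t, q s with hG
  have hGd : ∀ t, HasDerivAt G (q t) t := fun t => (hqc.integral_hasStrictDerivAt 0 t).hasDerivAt
  have hGc : Continuous G := continuous_iff_continuousAt.2 fun t => (hGd t).continuousAt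
  have hGc' : Continuous fun t => (G t : ℂ) := Complex.continuous_ofReal.comp hGc
  have hGw := hasWeakDerivOn_ofReal hqc hGd
  have hzq : z =ᵐ[volume] fun t => (q t : ℂ) := hw.mono fun t ht => by
    simp only [Complex.real_smul] at ht
    simp only [hq]
    push_cast
    linear_combination ht
  have hG0 : (G 0 : ℂ) = 0 := by simp [hG]
  -- On each half-line `v - G` is almost everywhere constant, and since `G 0 = 0` the constant is
  -- the one-sided limit of `v`. Equal limits glue the halves into one continuous derivative `G +
  -- L`.
  have hside : ∀ S : Set ℝ, IsOpen S → S.OrdConnected → S ⊆ {0}ᶜ →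
      (∀ ε > 0, (S ∩ Metric.ball 0 ε).Nonempty) → Tendsto v (𝓝[S] 0) (𝓝 L) →
      ∀ᵐ t, t ∈ S → v t = G t + L := by
    intro S hS hconn hsub hne hlim
    obtain ⟨c, hc⟩ := (hz.mono hsub).exists_sub_ae_eq_const hS hconn
      ((hne 1 one_pos).mono Set.inter_subset_left) (hGw.mono (Set.subset_univ S)) hzq
    have hLc := eq_of_tendsto_of_ae_eq hGc'
      (fun ε hε => ((hS.inter Metric.isOpen_ball).measure_pos volume (hne ε hε)).ne') hlim hc
    rw [hG0, add_zero] at hLc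
    refine hc.mono fun t ht htS => ?_
    rw [hLc, ← ht htS]
    ring
  have hvG : v =ᵐ[volume] fun t => (G t : ℂ) + L := by
    have h1 := hside (Set.Ioi 0) isOpen_Ioi Set.ordConnected_Ioi (fun t ht => ne_of_gt ht)
      (fun ε hε => ⟨ε / 2, half_pos hε, by simp [abs_of_pos hε, hε]⟩) hr
    have h2 := hside (Set.Iio 0) isOpen_Iio Set.ordConnected_Iio (fun t ht => ne_of_lt ht)
      (fun ε hε => ⟨-(ε / 2), by simp [hε], by simp [abs_of_pos hε, hε]⟩) hl
    have h3 : ∀ᵐ t : ℝ, t ≠ 0 := by simp [ae_iff]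
    filter_upwards [h1, h2, h3] with t h1 h2 h3
    rcases lt_or_gt_of_ne h3 with h | h
    · exact h2 h
    · exact h1 h
  have hGLc : Continuous fun t => (G t : ℂ) + L := hGc'.add continuous_const
  set P : ℝ → ℂ := fun t => ∫ s in (0 : ℝ)..t, ((G s : ℂ) + L) with hP
  have hPd : ∀ t, HasDerivAt P ((G t : ℂ) + L) t := fun t =>
    (hGLc.integral_hasStrictDerivAt 0 t).hasDerivAt
  have hPc : Continuous P := continuous_iff_continuousAt.2 fun t => (hPd t).continuousAt
  obtain ⟨c, hc⟩ := hv.exists_sub_ae_eq_const isOpen_univ Set.ordConnected_univ Set.univ_nonempty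
    (hasWeakDerivOn_of_hasDerivAt hGLc hPd) hvG
  have hfc : Continuous fun t => (f t : ℂ) := Complex.continuous_ofReal.comp h.continuous
  have hfP : ∀ t, (f t : ℂ) = c + P t := by
    have : (fun t => (f t : ℂ)) = fun t => c + P t :=
      Continuous.ae_eq_iff_eq volume hfc (continuous_const.add hPc) |>.1
        (hc.mono fun t ht => show (f t : ℂ) = c + P t by
          linear_combination ht (Set.mem_univ t))
    exact congrFun this
  have hfd : ∀ t, HasDerivAt f (G t + L.re) t := by
    intro t
    have h1 : HasDerivAt (fun t => (f t : ℂ)) ((G t : ℂ) + L) t := by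
      have : (fun t => (f t : ℂ)) = fun t => c + P t := funext hfP
      rw [this]
      exact (hPd t).const_add c
    simpa [Function.comp_def] using Complex.reCLM.hasFDerivAt.comp_hasDerivAt t h1
  refine ⟨fun t => G t + L.re, ⟨hfd, fun t => (hGd t).add_const _⟩, ?_, ?_⟩
  · simpa using hB.memLp.re
  · obtain ⟨v', hv', hv2⟩ := hB.exists_weakDeriv
    have h2 := ((hv2.ae_eq (hv'.ae_eq hv)).ae_eq hvG).re
    simpa using h2

/-- The Wronskian is constant, and integrable as a combination of products of `L²` functions, hence
zero. So `f₁ / f` is constant; positivity and normalization make it `1`. -/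
theorem IsPositiveGroundState.eq_of_isGround {a ξ L : ℝ} (ha : a ∈ Set.Ico (-1 : ℝ) 0)
    {f g f₁ : ℝ → ℝ} (h : IsGround a ξ L f g) (h₁ : IsPositiveGroundState a ξ f₁) : f₁ = f := by
  obtain ⟨g₁, hs, hf₁, hg₁⟩ := h₁.exists_isSol
  rw [h.groundEnergy_eq ha] at hs
  have hf : MemLp f 2 := (memLp_two_iff_integrable_sq h.sol.continuous_fst.aestronglyMeasurable).2
    h.integrable_sq_fst
  have hg : MemLp g 2 := (memLp_two_iff_integrable_sq h.sol.continuous_snd.aestronglyMeasurable).2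
    h.integrable_sq_snd
  set W : ℝ → ℝ := fun t => f t * g₁ t - f₁ t * g t with hW
  have hWd : ∀ t, HasDerivAt W 0 t := fun t =>
    (((h.sol.fst t).mul (hs.snd t)).sub ((hs.fst t).mul (h.sol.snd t))).congr_deriv (by ring)
  have hWc : ∀ t, W t = W 0 := fun t =>
    is_const_of_deriv_eq_zero (fun t => (hWd t).differentiableAt) (fun t => (hWd t).deriv) t 0
  have hWi : Integrable W := (hf.integrable_mul hg₁).sub (hf₁.integrable_mul hg)
  have hW0 : W 0 = 0 := by
    have : W = fun _ => W 0 := funext hWc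
    rw [this, integrable_const_iff] at hWi
    rcases hWi with h0 | h0
    · exact h0
    · have := h0.measure_univ_lt_top
      simp at this
  have hqd : ∀ t, HasDerivAt (fun t => f₁ t / f t) 0 t := fun t => by
    refine ((hs.fst t).fun_div (h.sol.fst t) (h.pos t).ne').congr_deriv ?_
    have : g₁ t * f t - f₁ t * g t = 0 := by
      rw [← hW0, ← hWc t]; simp only [hW]; ring
    rw [this, zero_div]
  set c := f₁ 0 / f 0
  have hc : ∀ t, f₁ t = c * f t := fun t => by
    have : f₁ t / f t = c :=
      is_const_of_deriv_eq_zero (fun t => (hqd t).differentiableAt) (fun t => (hqd t).deriv) t 0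
    rw [← this, div_mul_cancel₀ _ (h.pos t).ne']
  have hc0 : 0 < c := div_pos (h₁.pos 0) (h.pos 0)
  have hn := h₁.normalized
  simp only [hc, mul_pow] at hn
  rw [integral_const_mul, h.norm, mul_one] at hn
  have hc1 : c = 1 := by nlinarith
  funext t
  rw [hc, hc1, one_mul]

/-! ### Comparison of ground states at two parameters -/

/-- The Feynman–Hellmann integral `∫ ∂_ξ V_a(ξ, t) f(t)² dt`. -/
noncomputable def feynmanHellmann (a ξ : ℝ) (f : ℝ → ℝ) : ℝ :=
  ∫ t, 2 * (ξ + profile a t) * f t ^ 2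

namespace IsGround

variable {a ξ η L M : ℝ} {f g u v : ℝ → ℝ}

/-- `2|x| ≤ 1 + x²` with `x = ξ + profile a t`, and the potential energy is at most `L`. -/
theorem abs_feynmanHellmann_le (ha : a ∈ Set.Ico (-1 : ℝ) 0) (h : IsGround a ξ L f g) :
    |feynmanHellmann a ξ f| ≤ 1 + L := by
  have i1 := h.integrable_sq_fst.add (h.integrable_potential ha ξ)
  have i2 := h.integrable_sq_snd.add (h.integrable_potential ha ξ)
  have h1 : |feynmanHellmann a ξ f| ≤ ∫ t, (f t ^ 2 + potential a ξ t * f t ^ 2) := by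
    rw [feynmanHellmann, ← Real.norm_eq_abs]
    refine norm_integral_le_of_norm_le i1 (ae_of_all _ fun t => ?_)
    rw [Real.norm_eq_abs, abs_mul, abs_of_nonneg (sq_nonneg (f t)), potential_eq]
    have : |2 * (ξ + profile a t)| ≤ 1 + (ξ + profile a t) ^ 2 := by
      rw [abs_le]
      constructor <;> nlinarith [sq_nonneg (ξ + profile a t + 1), sq_nonneg (ξ + profile a t - 1)]
    nlinarith [mul_le_mul_of_nonneg_right this (sq_nonneg (f t))]
  rw [integral_add h.integrable_sq_fst (h.integrable_potential ha ξ), h.norm] at h1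
  have h2 : ∫ t, potential a ξ t * f t ^ 2 ≤ L := by
    rw [← h.integral_energy ha]
    exact integral_mono (h.integrable_potential ha ξ) i2 fun t =>
      le_add_of_nonneg_left (sq_nonneg (g t))
  linarith

/-- The Rayleigh bound of the energy at `η` by the ground state at `ξ`. -/
theorem energy_le (ha : a ∈ Set.Ico (-1 : ℝ) 0) (h : IsGround a ξ L f g)
    (h' : IsGround a η M u v) :
    M ≤ L + (η - ξ) * feynmanHellmann a ξ f + (η - ξ) ^ 2 := by
  have := h'.mul_integral_le_quadForm ha h.memB1
  rw [h.quadForm_eq, h.integral_energy_add ha] at this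
  simpa [h.norm, feynmanHellmann] using this

theorem continuous_div (h : IsGround a ξ L f g) : Continuous fun t => g t / f t :=
  h.sol.continuous_snd.div h.sol.continuous_fst fun t => (h.pos t).ne'

/-- The right side is the energy excess at `ξ` of the trial function `u`. With `energy_le` bounding
`M - L`, it becomes `O(|η - ξ|)`. -/
theorem integral_remainder_le (ha : a ∈ Set.Ico (-1 : ℝ) 0) (h : IsGround a ξ L f g)
    (h' : IsGround a η M u v) {R : ℝ} (hR : 0 ≤ R) :
    ∫ t in (-R)..R, (v t - g t / f t * u t) ^ 2 ≤
      M + (ξ - η) * feynmanHellmann a η u + (ξ - η) ^ 2 - L := by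
  have hF : ∀ t, u t = u 0 + ∫ s in (0 : ℝ)..t, v s := fun t => by
    rw [intervalIntegral.integral_eq_sub_of_hasDerivAt (fun s _ => h'.sol.fst s)
      (h'.sol.continuous_snd.intervalIntegrable _ _)]
    ring
  have := h.picone_le ha h'.sol.continuous_snd.locallyIntegrable hF h'.integrable_sq_snd
    h'.integrable_sq_weight hR
  have e : ∫ t, (v t ^ 2 + (potential a ξ t - L) * u t ^ 2) =
      (∫ t, (v t ^ 2 + potential a ξ t * u t ^ 2)) - L := by
    have i1 : Integrable fun t => v t ^ 2 + potential a ξ t * u t ^ 2 :=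
      h'.integrable_sq_snd.add (h'.integrable_potential ha ξ)
    rw [show (fun t => v t ^ 2 + (potential a ξ t - L) * u t ^ 2) =
      fun t => (v t ^ 2 + potential a ξ t * u t ^ 2) - L * u t ^ 2 from funext fun t => by ring,
      integral_sub i1 (h'.integrable_sq_fst.const_mul L), integral_const_mul, h'.norm, mul_one]
  rw [e, h'.integral_energy_add ha] at this
  exact this

/-- The quotient of two ground states varies little if the Picone remainder is small. -/
theorem abs_div_sub_div_le (h : IsGround a ξ L f g) (h' : IsGround a η M u v) {δ E : ℝ}
    (hδ : 0 < δ) (t : ℝ) (hE : ∫ s in (-|t|)..|t|, (v s - g s / f s * u s) ^ 2 ≤ E) :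
    |u t / f t - u 0 / f 0| ≤ (E / δ + δ * ∫ s in (-|t|)..|t|, ((f s)⁻¹) ^ 2) / 2 := by
  set r : ℝ → ℝ := fun s => v s - g s / f s * u s with hr
  have hrc : Continuous r :=
    h'.sol.continuous_snd.sub (h.continuous_div.mul h'.sol.continuous_fst)
  have hfi : Continuous fun s => (f s)⁻¹ :=
    h.sol.continuous_fst.inv₀ fun s => (h.pos s).ne'
  -- The quotient has derivative `r / f`, with `r` the Picone remainder; the product is then split
  -- by a weighted arithmetic–geometric inequality with free weight `δ`.
  have hd : ∀ s, HasDerivAt (fun s => u s / f s) (r s * (f s)⁻¹) s := fun s => by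
    refine ((h'.sol.fst s).fun_div (h.sol.fst s) (h.pos s).ne').congr_deriv ?_
    have := (h.pos s).ne'
    simp only [hr]
    field_simp
  have hF := intervalIntegral.integral_eq_sub_of_hasDerivAt (a := 0) (b := t) (fun s _ => hd s)
    ((hrc.mul hfi).intervalIntegrable _ _)
  have hbc : Continuous fun s => (r s ^ 2 / δ + δ * ((f s)⁻¹) ^ 2) / 2 := by fun_prop
  have hb : ∀ s, |r s * (f s)⁻¹| ≤ (r s ^ 2 / δ + δ * ((f s)⁻¹) ^ 2) / 2 := by
    intro s
    have e : r s ^ 2 / δ + δ * ((f s)⁻¹) ^ 2 = (r s ^ 2 + (δ * (f s)⁻¹) ^ 2) / δ := by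
      field_simp
    rw [e, le_div_iff₀ two_pos, le_div_iff₀ hδ, abs_mul, ← sq_abs (r s), ← sq_abs (δ * _), abs_mul,
      abs_of_pos hδ]
    nlinarith [sq_nonneg (|r s| - δ * |(f s)⁻¹|)]
  rw [← hF]
  calc |∫ s in (0 : ℝ)..t, r s * (f s)⁻¹|
      ≤ |∫ s in (0 : ℝ)..t, (r s ^ 2 / δ + δ * ((f s)⁻¹) ^ 2) / 2| := by
        rw [← Real.norm_eq_abs]
        exact intervalIntegral.norm_integral_le_abs_of_norm_le (ae_of_all _ fun s => hb s)
          (hbc.intervalIntegrable _ _)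
    _ ≤ |∫ s in (-|t|)..|t|, (r s ^ 2 / δ + δ * ((f s)⁻¹) ^ 2) / 2| := by
        refine intervalIntegral.abs_integral_mono_interval ?_
          (ae_of_all _ fun s => by simp only [Pi.zero_apply]; positivity)
          (hbc.intervalIntegrable _ _)
        rw [Set.uIoc_of_le (by linarith [abs_nonneg t] : -|t| ≤ |t|)]
        intro s hs
        rcases Set.mem_uIoc.1 hs with hs | hs
        · exact ⟨by linarith [abs_nonneg t, hs.1], hs.2.trans (le_abs_self t)⟩
        · exact ⟨by linarith [neg_abs_le t, hs.1], by linarith [abs_nonneg t, hs.2]⟩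
    _ = (∫ s in (-|t|)..|t|, r s ^ 2) / δ / 2 + (δ * ∫ s in (-|t|)..|t|, ((f s)⁻¹) ^ 2) / 2 := by
        have i1 : IntervalIntegrable (fun s => r s ^ 2 / δ) volume (-|t|) |t| :=
          Continuous.intervalIntegrable (by fun_prop) _ _
        have i2 : IntervalIntegrable (fun s => δ * ((f s)⁻¹) ^ 2) volume (-|t|) |t| :=
          Continuous.intervalIntegrable (by fun_prop) _ _
        rw [abs_of_nonneg (intervalIntegral.integral_nonneg (by linarith [abs_nonneg t])
          fun s _ => by positivity), intervalIntegral.integral_div, intervalIntegral.integral_add i1 i2,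
          intervalIntegral.integral_div, intervalIntegral.integral_const_mul]
        ring
    _ ≤ _ := by
        rw [add_div]
        gcongr

/-- Exponential decay, uniform for bounded parameters. -/
theorem le_uniform_mul_exp (ha : a ∈ Set.Ico (-1 : ℝ) 0) (h : IsGround a ξ L f g) {M C : ℝ}
    (hL : L ≤ M) (hξ : |ξ| ≤ C) (t : ℝ) :
    f t ≤ √(1 + M) * Real.exp ((M + 2 + C) / |a|) * Real.exp (-|t|) := by
  have ha0 : 0 < |a| := abs_pos.2 ha.2.ne
  have hM : 0 ≤ M := h.nonneg.trans hL
  refine h.sol.le_mul_exp_abs h.pos (fun s => ?_) (fun s hs => ?_) t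
  · exact Real.le_sqrt_of_sq_le ((h.sq_le ha s).trans (by linarith))
  · rw [div_le_iff₀' ha0] at hs
    linarith [le_potential ha (ξ := ξ) (C := M + 1) (by linarith) (by linarith)]

end IsGround

/-! ### Continuity of the ground state and differentiability of the energy -/

section Continuity

variable {a ξ : ℝ} (ha : a ∈ Set.Ico (-1 : ℝ) 0) {m : ℝ → ℝ} {F G : ℝ → ℝ → ℝ}
  (h : ∀ η, IsGround a η (m η) (F η) (G η))
include ha h

theorem energy_le_of_abs_sub_le_one {η : ℝ} (hη : |η - ξ| ≤ 1) :
    m η ≤ m ξ + (1 + m ξ) + 1 := by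
  have h1 := (h ξ).energy_le ha (h η)
  have h2 := (h ξ).abs_feynmanHellmann_le ha
  have h3 : (η - ξ) * feynmanHellmann a ξ (F ξ) ≤ 1 + m ξ := by
    refine (le_abs_self _).trans ?_
    rw [abs_mul]
    nlinarith [abs_nonneg (η - ξ), abs_nonneg (feynmanHellmann a ξ (F ξ))]
  have h4 : (η - ξ) ^ 2 ≤ 1 := by
    rw [← sq_abs]
    nlinarith [abs_nonneg (η - ξ)]
  linarith

theorem eventually_uniform_bound (ξ : ℝ) : ∃ A, 0 < A ∧ ∀ᶠ η in 𝓝[≠] ξ, ∀ t,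
    F η t ≤ A * Real.exp (-|t|) := by
  have hm := (h ξ).nonneg
  refine ⟨√(1 + (m ξ + (1 + m ξ) + 1)) *
    Real.exp ((m ξ + (1 + m ξ) + 1 + 2 + (|ξ| + 1)) / |a|), by positivity, ?_⟩
  · filter_upwards [nhdsWithin_le_nhds (Metric.closedBall_mem_nhds ξ one_pos)] with η hη t
    have hη' : |η - ξ| ≤ 1 := hη
    refine (h η).le_uniform_mul_exp ha (energy_le_of_abs_sub_le_one ha h hη')
      (C := |ξ| + 1) ?_ t
    have := abs_sub_abs_le_abs_sub η ξ
    linarith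

/-- The Picone remainder is `O(δ²)` with `δ = √|η - ξ|`. This `δ` balances the two terms of
`abs_div_sub_div_le`, both of order `δ`. -/
theorem tendsto_sub_mul (ξ t : ℝ) :
    Tendsto (fun η => F η t - F η 0 / F ξ 0 * F ξ t) (𝓝[≠] ξ) (𝓝 0) := by
  set D := 1 + (m ξ + (1 + m ξ) + 1) with hD
  have hm := (h ξ).nonneg
  set K := ∫ s in (-|t|)..|t|, ((F ξ s)⁻¹) ^ 2 with hK
  have hlim : Tendsto (fun η : ℝ => (2 * D + 2 + K) / 2 * √|η - ξ| * F ξ t) (𝓝[≠] ξ) (𝓝 0) := by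
    have : Continuous fun η : ℝ => (2 * D + 2 + K) / 2 * √|η - ξ| * F ξ t := by fun_prop
    simpa using (this.tendsto ξ).mono_left nhdsWithin_le_nhds
  refine squeeze_zero_norm' ?_ hlim
  filter_upwards [nhdsWithin_le_nhds (Metric.closedBall_mem_nhds ξ one_pos),
    self_mem_nhdsWithin] with η hη hne
  have hη' : |η - ξ| ≤ 1 := hη
  have hpos : 0 < |η - ξ| := abs_pos.2 (sub_ne_zero.2 hne)
  have hδ := Real.sqrt_pos.2 hpos
  have hsq := Real.mul_self_sqrt hpos.le
  set δ := √|η - ξ|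
  -- Two Feynman–Hellmann terms contribute at most `D |η - ξ|` each, and two squares at most `|η -
  -- ξ|` each.
  have hE : ∫ s in (-|t|)..|t|, (G η s - G ξ s / F ξ s * F η s) ^ 2 ≤ (2 * D + 2) * (δ * δ) := by
    refine ((h ξ).integral_remainder_le ha (h η) (abs_nonneg t)).trans ?_
    have h1 := (h ξ).energy_le ha (h η)
    have h2 : |feynmanHellmann a ξ (F ξ)| ≤ D :=
      ((h ξ).abs_feynmanHellmann_le ha).trans (by linarith)
    have h3 : |feynmanHellmann a η (F η)| ≤ D :=
      ((h η).abs_feynmanHellmann_le ha).trans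
        (by linarith [energy_le_of_abs_sub_le_one ha h hη'])
    have h4 : (η - ξ) * feynmanHellmann a ξ (F ξ) ≤ |η - ξ| * D := by
      refine (le_abs_self _).trans ?_
      rw [abs_mul]
      gcongr
    have h5 : (ξ - η) * feynmanHellmann a η (F η) ≤ |η - ξ| * D := by
      refine (le_abs_self _).trans ?_
      rw [abs_mul, abs_sub_comm]
      gcongr
    have h6 : (η - ξ) ^ 2 ≤ |η - ξ| := by
      rw [← sq_abs]
      nlinarith
    have h7 : (ξ - η) ^ 2 = (η - ξ) ^ 2 := by ring
    rw [hsq]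
    linarith
  have key := (h ξ).abs_div_sub_div_le (h η) hδ t hE
  rw [← mul_assoc, mul_div_assoc, div_self hδ.ne', mul_one] at key
  have hft := (h ξ).pos t
  have e : F η t - F η 0 / F ξ 0 * F ξ t = (F η t / F ξ t - F η 0 / F ξ 0) * F ξ t := by
    field_simp
  rw [e, Real.norm_eq_abs, abs_mul, abs_of_pos hft]
  refine mul_le_mul_of_nonneg_right (key.trans (le_of_eq ?_)) hft.le
  ring

/-- Both ground states have norm one, so the integral of `F η ² - c² F ξ ²` is `1 - c²` for the
ratio `c`. It tends to zero by dominated convergence, and `c` is positive. -/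
theorem tendsto_ratio (ξ : ℝ) : Tendsto (fun η => F η 0 / F ξ 0) (𝓝[≠] ξ) (𝓝 1) := by
  obtain ⟨A, hA, hev⟩ := eventually_uniform_bound ha h ξ
  have hf0 := (h ξ).pos 0
  have hc0 : ∀ η, 0 < F η 0 / F ξ 0 := fun η => div_pos ((h η).pos 0) hf0
  have hcb : ∀ᶠ η in 𝓝[≠] ξ, F η 0 / F ξ 0 ≤ A / F ξ 0 := hev.mono fun η hη => by
    have := hη 0
    rw [abs_zero, neg_zero, Real.exp_zero, mul_one] at this
    gcongr
  have hexp : Continuous fun t : ℝ => A * Real.exp (-|t|) := by fun_prop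
  have hAabs : ∀ t : ℝ, |A * Real.exp (-|t|)| ≤ A * Real.exp (-|t|) := fun t => by
    rw [abs_of_nonneg (by positivity)]
  have hdom : Integrable fun t : ℝ => (A * Real.exp (-|t|)) * (A * Real.exp (-|t|)) +
      (A / F ξ 0) ^ 2 * F ξ t ^ 2 :=
    (integrable_mul_of_decay hexp hexp hAabs hAabs).add ((h ξ).integrable_sq_fst.const_mul _)
  have hDCT : Tendsto (fun η => ∫ t, (F η t ^ 2 - (F η 0 / F ξ 0) ^ 2 * F ξ t ^ 2)) (𝓝[≠] ξ)
      (𝓝 (∫ _ : ℝ, (0 : ℝ))) := by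
    refine tendsto_integral_filter_of_dominated_convergence _
      (Eventually.of_forall fun η => (((h η).sol.continuous_fst.pow 2).sub
        (continuous_const.mul ((h ξ).sol.continuous_fst.pow 2))).aestronglyMeasurable) ?_ hdom
      (ae_of_all _ fun t => ?_)
    · filter_upwards [hev, hcb] with η hη hc
      refine ae_of_all _ fun t => ?_
      have h1 : F η t ^ 2 ≤ (A * Real.exp (-|t|)) * (A * Real.exp (-|t|)) := by
        rw [sq]
        exact mul_self_le_mul_self ((h η).pos t).le (hη t)
      have h2 : (F η 0 / F ξ 0) ^ 2 * F ξ t ^ 2 ≤ (A / F ξ 0) ^ 2 * F ξ t ^ 2 := by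
        have := (hc0 η).le
        gcongr
      refine (abs_sub _ _).trans ?_
      rw [abs_of_nonneg (sq_nonneg (F η t)), abs_of_nonneg (by positivity)]
      linarith
    · have h1 := tendsto_sub_mul ha h ξ t
      refine squeeze_zero_norm'
        (a := fun η => |F η t - F η 0 / F ξ 0 * F ξ t| * (A + A / F ξ 0 * F ξ t)) ?_
        (by simpa using h1.abs.mul_const (A + A / F ξ 0 * F ξ t))
      filter_upwards [hev, hcb] with η hη hc
      have hft := (h ξ).pos t
      rw [show F η t ^ 2 - (F η 0 / F ξ 0) ^ 2 * F ξ t ^ 2 = (F η t - F η 0 / F ξ 0 * F ξ t) *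
        (F η t + F η 0 / F ξ 0 * F ξ t) by ring, Real.norm_eq_abs, abs_mul]
      have h3 : F η t ≤ A := (hη t).trans
        (mul_le_of_le_one_right hA.le (Real.exp_le_one_iff.2 (by simp)))
      have h4 : F η 0 / F ξ 0 * F ξ t ≤ A / F ξ 0 * F ξ t := by gcongr
      rw [abs_of_nonneg (add_nonneg ((h η).pos t).le (mul_pos (hc0 η) hft).le)]
      gcongr
  have hval : ∀ η, ∫ t, (F η t ^ 2 - (F η 0 / F ξ 0) ^ 2 * F ξ t ^ 2) =
      1 - (F η 0 / F ξ 0) ^ 2 := fun η => by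
    rw [integral_sub (h η).integrable_sq_fst ((h ξ).integrable_sq_fst.const_mul _),
      integral_const_mul, (h η).norm, (h ξ).norm, mul_one]
  simp only [hval, integral_zero] at hDCT
  have h1 : Tendsto (fun η => (F η 0 / F ξ 0) ^ 2) (𝓝[≠] ξ) (𝓝 1) := by
    simpa using (tendsto_const_nhds (x := (1 : ℝ))).sub hDCT
  simpa [Real.sqrt_sq (hc0 _).le] using h1.sqrt

theorem tendsto_ground_apply (ξ t : ℝ) : Tendsto (fun η => F η t) (𝓝[≠] ξ) (𝓝 (F ξ t)) := by
  simpa using (tendsto_sub_mul ha h ξ t).add ((tendsto_ratio ha h ξ).mul_const (F ξ t))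

theorem tendsto_feynmanHellmann (ξ : ℝ) :
    Tendsto (fun η => feynmanHellmann a η (F η)) (𝓝[≠] ξ) (𝓝 (feynmanHellmann a ξ (F ξ))) := by
  obtain ⟨A, hA, hev⟩ := eventually_uniform_bound ha h ξ
  have hexp : Continuous fun t : ℝ => A * Real.exp (-|t|) := by fun_prop
  have hAabs : ∀ t : ℝ, |A * Real.exp (-|t|)| ≤ A * Real.exp (-|t|) := fun t => by
    rw [abs_of_nonneg (by positivity)]
  have hw : Continuous fun t : ℝ => 2 * (|ξ| + 1 + 1) * (1 + |t|) ^ 2 := by fun_prop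
  have hdom := integrable_weight_mul hw hexp hexp hAabs hAabs (K := 2 * (|ξ| + 1 + 1))
    fun t => by rw [abs_of_nonneg (by positivity)]
  refine tendsto_integral_filter_of_dominated_convergence _
    (Eventually.of_forall fun η => ((continuous_const.mul
      (continuous_const.add (continuous_profile a))).mul
      ((h η).sol.continuous_fst.pow 2)).aestronglyMeasurable) ?_ hdom (ae_of_all _ fun t => ?_)
  · filter_upwards [hev, nhdsWithin_le_nhds (Metric.closedBall_mem_nhds ξ one_pos)] with η hη hb
    have hb' : |η - ξ| ≤ 1 := hb
    have hηξ : |η| ≤ |ξ| + 1 := by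
      have := abs_sub_abs_le_abs_sub η ξ
      linarith
    refine ae_of_all _ fun t => ?_
    rw [Real.norm_eq_abs, abs_mul, abs_of_nonneg (sq_nonneg (F η t)), sq (F η t)]
    refine mul_le_mul ((abs_two_mul_add_profile_le ha η t).trans ?_)
      (mul_self_le_mul_self ((h η).pos t).le (hη t)) (mul_self_nonneg _) (by positivity)
    gcongr
  · have h1 : Tendsto (fun η : ℝ => 2 * (η + profile a t)) (𝓝[≠] ξ) (𝓝 (2 * (ξ + profile a t))) := by
      have : Continuous fun η : ℝ => 2 * (η + profile a t) := by fun_prop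
      exact (this.tendsto ξ).mono_left nhdsWithin_le_nhds
    exact h1.mul ((tendsto_ground_apply ha h ξ t).pow 2)

/-- `energy_le` used in both directions places `m η - m ξ` between `(η - ξ) e - (η - ξ)²` and `(η -
ξ) d + (η - ξ)²`, where `d` and `e` are the Feynman–Hellmann integrals at `ξ` and `η`; and `e → d`.
-/
theorem hasDerivAt_energy (ξ : ℝ) : HasDerivAt m (feynmanHellmann a ξ (F ξ)) ξ := by
  rw [hasDerivAt_iff_tendsto_slope, ← tendsto_sub_nhds_zero_iff]
  have h1 := tendsto_sub_nhds_zero_iff.2 (tendsto_feynmanHellmann ha h ξ)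
  have h2 : Tendsto (fun η : ℝ => |η - ξ|) (𝓝[≠] ξ) (𝓝 0) := by
    have : Continuous fun η : ℝ => |η - ξ| := by fun_prop
    simpa using (this.tendsto ξ).mono_left nhdsWithin_le_nhds
  refine squeeze_zero_norm' ?_ (by simpa using h1.abs.add h2)
  filter_upwards [self_mem_nhdsWithin] with η hne
  have hne' : η - ξ ≠ 0 := sub_ne_zero.2 hne
  have hpos : 0 < |η - ξ| := abs_pos.2 hne'
  set d := feynmanHellmann a ξ (F ξ)
  set e := feynmanHellmann a η (F η)
  have e1 := (h ξ).energy_le ha (h η)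
  have e2 := (h η).energy_le ha (h ξ)
  have hs : slope m ξ η - d = (m η - m ξ - (η - ξ) * d) / (η - ξ) := by
    rw [slope_def_field]
    field_simp
  rw [hs, Real.norm_eq_abs, abs_div, div_le_iff₀ hpos]
  have h3 : (η - ξ) * (e - d) - (η - ξ) ^ 2 ≤ m η - m ξ - (η - ξ) * d := by nlinarith
  have h4 : m η - m ξ - (η - ξ) * d ≤ (η - ξ) ^ 2 := by linarith
  have h5 : (|e - d| + |η - ξ|) * |η - ξ| = |(η - ξ) * (e - d)| + (η - ξ) ^ 2 := by
    rw [abs_mul, ← sq_abs (η - ξ)]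
    ring
  rw [h5, abs_le]
  constructor
  · linarith [neg_abs_le ((η - ξ) * (e - d))]
  · linarith [abs_nonneg ((η - ξ) * (e - d))]

end Continuity

end StepField

theorem propositionA5 (a ξ : ℝ) (ha : a ∈ Set.Ico (-1 : ℝ) 0) :
    (∃! f : ℝ → ℝ, StepField.IsPositiveGroundState a ξ f) ∧
    ∀ f : ℝ → ℝ, StepField.IsPositiveGroundState a ξ f →
      ∃ γ : ℝ,
        Tendsto (fun t => deriv f t / f t) (𝓝[>] 0) (𝓝 γ) ∧
        Tendsto (fun t => deriv f t / f t) (𝓝[<] 0) (𝓝 γ) ∧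
        HasDerivAt (fun η : ℝ => StepField.groundEnergy a η)
          ((1 - 1 / a) * (γ ^ 2 + StepField.groundEnergy a ξ - ξ ^ 2) * |f 0| ^ 2) ξ := by
  choose m F G h using fun η => StepField.exists_isGround ha η
  have hm : (fun η => StepField.groundEnergy a η) = m := funext fun η => (h η).groundEnergy_eq ha
  have huniq : ∀ f, StepField.IsPositiveGroundState a ξ f → f = F ξ := fun f hf => hf.eq_of_isGround ha (h ξ)
  refine ⟨⟨F ξ, (h ξ).isPositiveGroundState ha, huniq⟩, fun f hf => ?_⟩
  obtain rfl := huniq f hf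
  have hlim : Tendsto (fun t => deriv (F ξ) t / F ξ t) (𝓝 0) (𝓝 (G ξ 0 / F ξ 0)) := by
    rw [show deriv (F ξ) = G ξ from funext fun t => ((h ξ).sol.fst t).deriv]
    exact (h ξ).continuous_div.tendsto 0
  refine ⟨G ξ 0 / F ξ 0, hlim.mono_left nhdsWithin_le_nhds, hlim.mono_left nhdsWithin_le_nhds, ?_⟩
  rw [hm, (h ξ).groundEnergy_eq ha]
  refine (StepField.hasDerivAt_energy ha h ξ).congr_deriv ?_
  rw [StepField.feynmanHellmann, (h ξ).integral_profile ha, sq_abs]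
  have := ((h ξ).pos 0).ne'
  have hF : (G ξ 0 / F ξ 0) ^ 2 * F ξ 0 ^ 2 = G ξ 0 ^ 2 := by rw [← mul_pow, div_mul_cancel₀ _ this]
  rw [← hF]
  ring
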